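/- Proposition. NPRR is not worst-case optimal (not even up to a log factor) for families of problem instances defined by cardinality constraints on projections, while leapfrog triejoin is optimal up to a log factor on the family below. Consider the triangle query $Q(a,b,c)=R(a,b),S(b,c),T(a,c)$ on finite relations over $\mathbb N$. For $n\in\mathbb N$ let $\mathbf K_n$ be the class of instances $(R,S,T)$ with $$|R(a,\_)|\le n^{3/8},\quad |R(\_,b)|\le n^{5/8},\quad |S(b,\_)|\le n^{5/8},\quad |S(\_,c)|\le n^{3/8},\quad |T(a,\_)|\le n,\quad |T(\_,c)|\le 1,$$ where $E(x,\_)$ and $E(\_,y)$ are the two projections of a binary relation $E(x,y)$. Let $q(n)$ be the largest size of a query result, and $M(n)$ the largest cardinality of a relation, over the instances in $\mathbf K_n$. With $[m]=\{1,\dots,m\}$, let $\mathcal A_n$ be the product instance $$R=[\lfloor n^{3/8}\rfloor]\times[\lfloor n^{5/8}\rfloor],\quad S=[\lfloor n^{5/8}\rfloor]\times[\lfloor n^{3/8}\rfloor],\quad T=[n]\times[1].$$ Leapfrog triejoin: the three variables are bound in turn, in some fixed variable ordering, by leapfrog joins of the two relations containing the variable, over relations given as sorted tries. NPRR with threshold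 $\tau\ge 0$: a value $b\in R(\_,b)$ is heavy if it appears in more than $\tau$ tuples of $R$; $D$ is the set of heavy values and $G\subseteq R$ the set of tuples whose $b$ is not heavy; the algorithm constructs $D\times T$ and filters it with hash tables on $S$ and $R$, constructs $G\bowtie S$ and filters it with a hash table on $T$, and returns the union. Running times count RAM steps; hash table operations take unit time. Both algorithms compute the query result (for every variable ordering, every $\tau\ge0$ and every instance). Moreover: 1. For every variable ordering, leapfrog triejoin runs in time $O(n\log n)$ over $\mathbf K_n$ ($n\ge2$), and in time $O(q(n)\log M(n))$, i.e. it is worst-case optimal for $(\mathbf K_n)$ up to a log factor. 2. $\mathcal A_n\in\mathbf K_n$ for all $n$. There are constants $0<c\le C$, independent of $n$ and $\tau$, such that for all $n\ge1$ and all $\tau\ge0$ the running time $t$ of NPRR on $\mathcal A_n$ with threshold $\tau$ satisfies (a) $c\,n^{1.375}\le t\le C\,n^{1.375}$ if $\tau\ge\lfloor n^{3/8}\rfloor$; (b) $c\,n^{1.625}\le t\le C\,n^{1.625}$ if $\tau<\lfloor n^{3/8}\rfloor$. In particular $t\ge c\,n^{1.375}$ for every $\tau$, and $\Theta(n^{1.375})$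 is the running time with the best choice of $\tau$. Further, if $\tau\ge\lfloor n^{3/8}\rfloor$, then NPRR takes at most $C\,n^{1.375}$ steps on every instance in $\mathbf K_n$, so its worst-case running time over $\mathbf K_n$ is then $\Theta(n^{1.375})$. 3. For every choice of thresholds $\tau\ge0$, which may depend on $n$ and on the instance, NPRR does not run in time $O(q(n)\log M(n))$ over $(\mathbf K_n)$, i.e. it is not worst-case optimal for this family, even up to a log factor. -/

import Mathlib

/-! ### Computations with a step count -/

/-- A value together with the number of elementary (RAM) steps spent on computing it. -/
structure Timed (α : Type) where
  val : α
  time : ℕ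

namespace Timed

/-- Add `t` steps to a computation. -/
def delay {α : Type} (t : ℕ) (x : Timed α) : Timed α := ⟨x.val, t + x.time⟩

instance : Monad Timed where
  pure a := ⟨a, 0⟩
  bind x f := ⟨(f x.val).val, x.time + (f x.val).time⟩

/-- A `for` loop over an array; each iteration costs one step plus the steps of its body.  The
results of the iterations are collected in order. -/
def forEach {α β : Type} : List α → (α → Timed (List β)) → Timed (List β)
  | [], _ => ⟨[], 0⟩
  | x :: xs, f =>
    let r := f x
    let rest := forEach xs f
    ⟨r.val ++ rest.val, 1 + r.time + rest.time⟩

end Timed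

/-! ### Instances of the triangle query `Q(a,b,c) = R(a,b), S(b,c), T(a,c)` -/

/-- A finite structure over the signature `R(a,b), S(b,c), T(a,c)` with universe inside `ℕ`. -/
structure TriDB where
  R : Finset (ℕ × ℕ)
  S : Finset (ℕ × ℕ)
  T : Finset (ℕ × ℕ)

/-- The projection `E(x,_)` of a binary relation. -/
def projFst (E : Finset (ℕ × ℕ)) : Finset ℕ := E.image Prod.fst

/-- The projection `E(_,y)` of a binary relation. -/
def projSnd (E : Finset (ℕ × ℕ)) : Finset ℕ := E.image Prod.snd

namespace TriDB

/-- The query result: all `(a,b,c)` with `(a,b) ∈ R`, `(b,c) ∈ S`, `(a,c) ∈ T`. -/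
def result (A : TriDB) : Finset (ℕ × ℕ × ℕ) :=
  (projFst A.R ×ˢ projSnd A.R ×ˢ projSnd A.S).filter fun t =>
    (t.1, t.2.1) ∈ A.R ∧ (t.2.1, t.2.2) ∈ A.S ∧ (t.1, t.2.2) ∈ A.T

theorem mem_result (A : TriDB) (a b c : ℕ) :
    (a, b, c) ∈ A.result ↔ (a, b) ∈ A.R ∧ (b, c) ∈ A.S ∧ (a, c) ∈ A.T := by
  simp only [result, projFst, projSnd, Finset.mem_filter, Finset.mem_product, Finset.mem_image,
    Prod.exists, exists_and_right, exists_eq_right, and_iff_right_iff_imp]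
  rintro ⟨h1, h2, -⟩
  exact ⟨⟨b, h1⟩, ⟨a, h1⟩, ⟨b, h2⟩⟩

/-- The cardinality of the largest relation of an instance. -/
def maxCard (A : TriDB) : ℕ := max A.R.card (max A.S.card A.T.card)

end TriDB

/-! ### Families defined by cardinality constraints on projections -/

/-- Bounds, growing with the parameter `n`, on the cardinalities of the six unary projections. -/
structure ProjBounds where
  Ra : ℕ → ℝ
  Rb : ℕ → ℝ
  Sb : ℕ → ℝ
  Sc : ℕ → ℝ
  Ta : ℕ → ℝ
  Tc : ℕ → ℝ
  mono : Monotone Ra ∧ Monotone Rb ∧ Monotone Sb ∧ Monotone Sc ∧ Monotone Ta ∧ Monotone Tc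

/-- The family of problem instances given by constraints on the sizes of projections. -/
def ProjBounds.family (β : ProjBounds) (n : ℕ) : Set TriDB :=
  { A | ((projFst A.R).card : ℝ) ≤ β.Ra n ∧ ((projSnd A.R).card : ℝ) ≤ β.Rb n ∧
        ((projFst A.S).card : ℝ) ≤ β.Sb n ∧ ((projSnd A.S).card : ℝ) ≤ β.Sc n ∧
        ((projFst A.T).card : ℝ) ≤ β.Ta n ∧ ((projSnd A.T).card : ℝ) ≤ β.Tc n }

theorem ProjBounds.family_mono (β : ProjBounds) : Monotone β.family := by
  intro i j hij A hA
  obtain ⟨m1, m2, m3, m4, m5, m6⟩ := β.mono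
  obtain ⟨h1, h2, h3, h4, h5, h6⟩ := hA
  exact ⟨h1.trans (m1 hij), h2.trans (m2 hij), h3.trans (m3 hij), h4.trans (m4 hij),
    h5.trans (m5 hij), h6.trans (m6 hij)⟩

theorem natCast_rpow_monotone {e : ℝ} (he : 0 ≤ e) : Monotone fun n : ℕ => (n : ℝ) ^ e :=
  fun _ _ hij => Real.rpow_le_rpow (Nat.cast_nonneg _) (Nat.cast_le.2 hij) he

/-- `|R(a,_)| ≤ n^{3/8}`, `|R(_,b)| ≤ n^{5/8}`, `|S(b,_)| ≤ n^{5/8}`, `|S(_,c)| ≤ n^{3/8}`,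
`|T(a,_)| ≤ n`, `|T(_,c)| ≤ 1`. -/
noncomputable def skewBounds : ProjBounds where
  Ra n := (n : ℝ) ^ (3 / 8 : ℝ)
  Rb n := (n : ℝ) ^ (5 / 8 : ℝ)
  Sb n := (n : ℝ) ^ (5 / 8 : ℝ)
  Sc n := (n : ℝ) ^ (3 / 8 : ℝ)
  Ta n := (n : ℝ)
  Tc _ := 1
  mono := ⟨natCast_rpow_monotone (by norm_num), natCast_rpow_monotone (by norm_num),
    natCast_rpow_monotone (by norm_num), natCast_rpow_monotone (by norm_num),
    fun _ _ h => Nat.cast_le.2 h, fun _ _ _ => le_rfl⟩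

/-- The product instance `R = [n^{3/8}] × [n^{5/8}]`, `S = [n^{5/8}] × [n^{3/8}]`,
`T = [n] × [1]`, where `[m] = {1, …, m}` and non-integral powers are rounded down. -/
noncomputable def productInstance (n : ℕ) : TriDB where
  R := Finset.Icc 1 ⌊(n : ℝ) ^ (3 / 8 : ℝ)⌋₊ ×ˢ Finset.Icc 1 ⌊(n : ℝ) ^ (5 / 8 : ℝ)⌋₊
  S := Finset.Icc 1 ⌊(n : ℝ) ^ (5 / 8 : ℝ)⌋₊ ×ˢ Finset.Icc 1 ⌊(n : ℝ) ^ (3 / 8 : ℝ)⌋₊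
  T := Finset.Icc 1 n ×ˢ Finset.Icc 1 1

/-- `q n` is the largest result size, and `M n` the largest cardinality of a relation, over the
instances in `K n`. -/
def IsExtremal (K : ℕ → Set TriDB) (q M : ℕ → ℕ) : Prop :=
  ∀ n, IsGreatest ((fun A : TriDB => A.result.card) '' K n) (q n) ∧
    IsGreatest (TriDB.maxCard '' K n) (M n)

/-- An algorithm that takes `time n A` steps on `A ∈ K n` is worst-case optimal for the family
`K`, up to a log factor: it runs in `O(q(n) log M(n))` time over `K`, where `q(n)` is the largest
result size and `M(n)` the largest relation size in `K n`. -/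
def WorstCaseOptimalUpToLog (K : ℕ → Set TriDB) (time : ℕ → TriDB → ℕ) : Prop :=
  ∃ q M : ℕ → ℕ, IsExtremal K q M ∧
    ∃ C : ℝ, ∃ n₀ : ℕ, ∀ n ≥ n₀, ∀ A ∈ K n,
      (time n A : ℝ) ≤ C * ((q n : ℝ) * Real.logb 2 (M n))

/-! ### Linear iterators

A linear iterator is a position in a sorted array of keys.  `key`, `atEnd` and `next` are constant
time; `seek` is a galloping search that starts at the current position, so it takes
`O(log N)` steps, and visiting `m` of `N` keys in order takes amortized `O(1 + log (N / m))`. -/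

/-- Binary search for the least position in `[lo, hi]` that is `hi` or holds a key `≥ x`; one step
for each array access. -/
def bsearch (keys : Array ℕ) (x lo hi : ℕ) : Timed ℕ :=
  if lo < hi then
    if keys.getD ((lo + hi) / 2) 0 < x then
      (bsearch keys x ((lo + hi) / 2 + 1) hi).delay 1
    else
      (bsearch keys x lo ((lo + hi) / 2)).delay 1
  else ⟨lo, 0⟩
termination_by hi - lo
decreasing_by all_goals omega

/-- Galloping search from position `lo`: probe at doubling distances `step`, then search the last
interval.  Returns the least position `≥ lo` that is at the end or holds a key `≥ x`. -/
def gallop (keys : Array ℕ) (x lo step : ℕ) : Timed ℕ :=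
  if lo + step < keys.size ∧ keys.getD (lo + step) 0 < x then
    (gallop keys x (lo + step + 1) (2 * step)).delay 1
  else
    (bsearch keys x lo (min (lo + step) keys.size)).delay 1
termination_by keys.size - lo
decreasing_by omega

theorem le_bsearch (keys : Array ℕ) (x lo hi : ℕ) : lo ≤ (bsearch keys x lo hi).val := by
  fun_induction bsearch keys x lo hi with
  | case1 lo hi h h' ih => simp only [Timed.delay]; omega
  | case2 lo hi h h' ih => simpa only [Timed.delay] using ih
  | case3 lo hi h => exact le_rfl

theorem le_gallop (keys : Array ℕ) (x lo step : ℕ) : lo ≤ (gallop keys x lo step).val := by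
  fun_induction gallop keys x lo step with
  | case1 lo step h ih => simp only [Timed.delay]; omega
  | case2 lo step h => exact le_bsearch keys x lo _

theorem lt_gallop (keys : Array ℕ) (x lo : ℕ) (h : lo < keys.size) (hx : keys.getD lo 0 < x) :
    lo < (gallop keys x lo 1).val := by
  rw [gallop]
  split_ifs with h'
  · have := le_gallop keys x (lo + 1 + 1) (2 * 1)
    simp only [Timed.delay]; omega
  · have hm : min (lo + 1) keys.size = lo + 1 := by omega
    have hd : (lo + (lo + 1)) / 2 = lo := by omega
    rw [hm, bsearch, if_pos (Nat.lt_succ_self lo), hd, if_pos hx]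
    exact le_bsearch keys x (lo + 1) (lo + 1)

structure Iter where
  keys : Array ℕ
  pos : ℕ

namespace Iter

/-- The key at the current position (irrelevant if the iterator is at its end). -/
def key (i : Iter) : ℕ := i.keys.getD i.pos 0

abbrev atEnd (i : Iter) : Prop := i.keys.size ≤ i.pos

def next (i : Iter) : Timed Iter := ⟨{ i with pos := i.pos + 1 }, 1⟩

/-- Move to the least key `≥ x`, or to the end if there is none. -/
def seek (i : Iter) (x : ℕ) : Timed Iter :=
  let r := gallop i.keys x i.pos 1
  ⟨{ i with pos := r.val }, r.time⟩

/-- The number of keys not yet passed. -/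
def remaining (i : Iter) : ℕ := i.keys.size - i.pos

end Iter

/-! ### Leapfrog join of two unary relations -/

/-- The state of a leapfrog join: the array `Iter[0..1]` of iterators and the index `p` of the
iterator to be moved next (indices are modulo `2`). -/
structure Leapfrog where
  iter : Fin 2 → Iter
  p : Fin 2

namespace Leapfrog

/-- The leapfrog join is at its end as soon as one of its iterators is. -/
abbrev atEnd (s : Leapfrog) : Prop := (s.iter 0).atEnd ∨ (s.iter 1).atEnd

def remaining (s : Leapfrog) : ℕ := (s.iter 0).remaining + (s.iter 1).remaining

/-- Replace the iterator `Iter[p]` by `i`. -/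
def setCur (s : Leapfrog) (i : Iter) : Leapfrog := { s with iter := Function.update s.iter s.p i }

/-- `p := p + 1 mod 2`. -/
def advance (s : Leapfrog) : Leapfrog := { s with p := s.p + 1 }

theorem remaining_setCur (s : Leapfrog) (i : Iter) :
    (s.setCur i).remaining + (s.iter s.p).remaining = s.remaining + i.remaining := by
  obtain ⟨it, p⟩ := s
  match p with
  | 0 => simp [setCur, remaining]; omega
  | 1 => simp [setCur, remaining]; omega

theorem remaining_advance (s : Leapfrog) : s.advance.remaining = s.remaining := rfl

theorem search_decreasing (s : Leapfrog) (x : ℕ) (hx : (s.iter s.p).key < x)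
    (he : ¬ ((s.iter s.p).seek x).val.atEnd) :
    (s.setCur ((s.iter s.p).seek x).val).advance.remaining < s.remaining := by
  rw [remaining_advance]
  have h := remaining_setCur s ((s.iter s.p).seek x).val
  have hle := le_gallop (s.iter s.p).keys x (s.iter s.p).pos 1
  have hlt := lt_gallop (s.iter s.p).keys x (s.iter s.p).pos
  simp only [Iter.atEnd, Iter.remaining, Iter.seek, Iter.key] at *
  have := hlt (by omega) hx
  omega

/-- leapfrog-search: `x` is the key of `Iter[p]` (the least) and `x'` the key of `Iter[p-1]` (the
largest), so `x' ≤ x` means that all iterators are at the same key.  Otherwise `Iter[p]` seeks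
`x'`.  An iteration of the loop costs one step besides its seek. -/
def search (s : Leapfrog) : Timed Leapfrog :=
  let x' := (s.iter (s.p - 1)).key
  let x := (s.iter s.p).key
  if _hx : x' ≤ x then ⟨s, 1⟩
  else
    let r := (s.iter s.p).seek x'
    if _he : r.val.atEnd then ⟨s.setCur r.val, 1 + r.time⟩
    else (search (s.setCur r.val).advance).delay (1 + r.time)
termination_by s.remaining
decreasing_by exact search_decreasing s _ (not_le.1 _hx) _he

/-- leapfrog-init on two sorted arrays: order the two iterators by their keys and search. -/
def init (A B : Array ℕ) : Timed Leapfrog :=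
  let s : Leapfrog := ⟨![⟨A, 0⟩, ⟨B, 0⟩], if A.getD 0 0 ≤ B.getD 0 0 then 0 else 1⟩
  if s.atEnd then ⟨s, 1⟩ else (search s).delay 2

/-- leapfrog-next. -/
def next (s : Leapfrog) : Timed Leapfrog :=
  let r := (s.iter s.p).next
  if r.val.atEnd then ⟨s.setCur r.val, 1 + r.time⟩
  else (search (s.setCur r.val).advance).delay (1 + r.time)

theorem remaining_search_le (s : Leapfrog) : (search s).val.remaining ≤ s.remaining := by
  fun_induction search s with
  | case1 s x' x h => exact le_rfl
  | case2 s x' x h r he =>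
    have h1 := remaining_setCur s r.val
    have h2 := le_gallop (s.iter s.p).keys x' (s.iter s.p).pos 1
    have h3 : r.val.remaining ≤ (s.iter s.p).remaining := by
      simp only [r, Iter.remaining, Iter.seek]; omega
    show (s.setCur r.val).remaining ≤ _
    omega
  | case3 s x' x h r he ih =>
    exact ih.trans (search_decreasing s x' (not_le.1 h) he).le

theorem remaining_next_lt (s : Leapfrog) (hs : ¬ s.atEnd) :
    s.next.val.remaining < s.remaining := by
  have h1 := remaining_setCur s (s.iter s.p).next.val
  have hp : ¬ (s.iter s.p).atEnd := by
    intro hc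
    apply hs
    generalize hq : s.p = q at hc
    match q with
    | 0 => exact Or.inl hc
    | 1 => exact Or.inr hc
  have h3 : (s.iter s.p).next.val.remaining < (s.iter s.p).remaining := by
    simp only [Iter.remaining, Iter.next, Iter.atEnd] at *; omega
  have h4 := remaining_search_le (s.setCur (s.iter s.p).next.val).advance
  rw [remaining_advance] at h4
  unfold next
  simp only
  split_ifs
  · show (s.setCur _).remaining < _
    omega
  · show (search _).val.remaining < _
    omega

/-- Visit all results of the leapfrog join, running `body` at each of them and collecting the
output; one step of overhead for each test of `atEnd`. -/
def forEach {β : Type} (body : Leapfrog → Timed (List β)) (s : Leapfrog) : Timed (List β) :=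
  if _h : s.atEnd then ⟨[], 1⟩
  else
    let r := body s
    let s' := s.next
    let rest := forEach body s'.val
    ⟨r.val ++ rest.val, 1 + r.time + s'.time + rest.time⟩
termination_by s.remaining
decreasing_by exact remaining_next_lt s _h

/-- One level of the triejoin: triejoin-open (one `open` step for each of the two trie iterators,
then leapfrog-init), a traversal of the level, and triejoin-up (one `up` step for each iterator).
At each result, `body` is given the position in `A`, the position in `B`, and the key. -/
def level {β : Type} (A B : Array ℕ) (body : ℕ → ℕ → ℕ → Timed (List β)) : Timed (List β) :=
  let s := init A B
  let r := forEach (fun s => body (s.iter 0).pos (s.iter 1).pos (s.iter 0).key) s.val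
  ⟨r.val, 2 + s.time + r.time + 2⟩

end Leapfrog

/-! ### Leapfrog triejoin -/

/-- A binary relation `E(x,y)` stored as a trie: the sorted array of the keys `x`, and for each of
them a pointer to the sorted array of its children `y`. -/
structure Trie where
  keys : Array ℕ
  child : Array (Array ℕ)

/-- The trie presentation of `E`. -/
def Trie.ofRel (E : Finset (ℕ × ℕ)) : Trie where
  keys := ((projFst E).sort (· ≤ ·)).toArray
  child := (((projFst E).sort (· ≤ ·)).map fun x =>
    ((projSnd (E.filter fun e => e.1 = x)).sort (· ≤ ·)).toArray).toArray

/-- The array presented below position `i` of the first level. -/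
def Trie.openAt (t : Trie) (i : ℕ) : Array ℕ := t.child.getD i #[]

/-- Leapfrog triejoin for `E(x,y), F(y,z), G(x,z)` with variable ordering `[x,y,z]`: leapfrog joins
of `E(x,_), G(x,_)`, then of `E_x(y), F(y,_)`, then of `F_y(z), G_x(z)`.  Emitting a tuple costs
one step. -/
def triejoin (E F G : Trie) : Timed (List (ℕ × ℕ × ℕ)) :=
  Leapfrog.level E.keys G.keys fun i k x =>
    Leapfrog.level (E.openAt i) F.keys fun _ j y =>
      Leapfrog.level (F.openAt j) (G.openAt k) fun _ _ z => ⟨[(x, y, z)], 1⟩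

/-- The atom of the triangle query on the distinct variables `u` and `v` (`a, b, c` are numbered
`0, 1, 2`), with `u` in the first column. -/
def TriDB.atom (A : TriDB) : Fin 3 → Fin 3 → Finset (ℕ × ℕ)
  | 0, 1 => A.R
  | 1, 0 => A.R.image Prod.swap
  | 1, 2 => A.S
  | 2, 1 => A.S.image Prod.swap
  | 0, 2 => A.T
  | 2, 0 => A.T.image Prod.swap
  | _, _ => ∅

/-- Leapfrog triejoin for the triangle query with variable ordering `[σ 0, σ 1, σ 2]`, on relations
that are provided in sorted order consistent with the variable ordering.  The emitted tuples are
written as `(a, b, c)`. -/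
def leapfrogTriejoin (σ : Equiv.Perm (Fin 3)) (A : TriDB) : Timed (List (ℕ × ℕ × ℕ)) :=
  let r := triejoin (Trie.ofRel (A.atom (σ 0) (σ 1))) (Trie.ofRel (A.atom (σ 1) (σ 2)))
    (Trie.ofRel (A.atom (σ 0) (σ 2)))
  ⟨r.val.map fun t =>
    let v : Fin 3 → ℕ := ![t.1, t.2.1, t.2.2] ∘ σ.symm
    (v 0, v 1, v 2), r.time⟩

/-! ### The NPRR algorithm on the triangle query

Hash table operations (insertion, update, lookup) cost one step each. -/

/-- Build a hash table that holds the given keys. -/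
def buildHashSet {α : Type} [DecidableEq α] (l : List α) : Timed (Finset α) :=
  ⟨l.toFinset, l.length⟩

/-- Build a hash table that maps a key `b` to the array of all `c` with `(b, c)` in the list. -/
def buildHashIndex (l : List (ℕ × ℕ)) : Timed (ℕ → List ℕ) :=
  ⟨fun b => (l.filter fun e => e.1 = b).map Prod.snd, l.length⟩

/-- Build a hash table that maps a key `b` to the number of pairs `(a, b)` in the list. -/
def buildHashCount (l : List (ℕ × ℕ)) : Timed (ℕ → ℕ) :=
  ⟨fun b => (l.filter fun e => e.2 = b).length, l.length⟩

/-- The elements of a list that pass a test costing `t` steps. -/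
def filterTimed {α : Type} (t : ℕ) (P : α → Prop) [DecidablePred P] (l : List α) :
    Timed (List α) :=
  Timed.forEach l fun x => ⟨if P x then [x] else [], t⟩

open Classical in
/-- NPRR for `R(a,b), S(b,c), T(a,c)` with heavy-key threshold `τ`.  A join key `b ∈ R(_,b)` is
heavy if it appears in more than `τ` tuples of `R`; `D` is the set of heavy join keys and `G ⊆ R`
the set of tuples without a heavy join key.  The algorithm (1) constructs `D × T` and filters it
with hash tables on `S` and `R`, (2) constructs `G ⋈ S` and filters it with a hash table on `T`,
and returns the union of the two results. -/
noncomputable def nprr (τ : ℝ) (A : TriDB) : Timed (List (ℕ × ℕ × ℕ)) := do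
  let hR ← buildHashSet A.R.toList
  let hS ← buildHashSet A.S.toList
  let hT ← buildHashSet A.T.toList
  let idxS ← buildHashIndex A.S.toList
  let cnt ← buildHashCount A.R.toList
  let D ← filterTimed 1 (fun b => τ < (cnt b : ℝ)) (projSnd A.R).toList
  let hD ← buildHashSet D
  let G ← filterTimed 1 (fun e : ℕ × ℕ => e.2 ∉ hD) A.R.toList
  let DT ← Timed.forEach D fun b =>
    Timed.forEach A.T.toList fun e => ⟨[(e.1, b, e.2)], 1⟩
  let out₁ ← filterTimed 2 (fun t : ℕ × ℕ × ℕ => (t.2.1, t.2.2) ∈ hS ∧ (t.1, t.2.1) ∈ hR) DT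
  let GS ← Timed.forEach G fun e =>
    Timed.forEach (idxS e.2) fun c => ⟨[(e.1, e.2, c)], 1⟩
  let out₂ ← filterTimed 1 (fun t : ℕ × ℕ × ℕ => (t.1, t.2.2) ∈ hT) GS
  return out₁ ++ out₂

/-!
A move of the leapfrog search that is followed by another one brings both iterators forward, so the
number of moves can be charged to either one of the two arrays, in particular to the smaller one,
and each move is a galloping search of logarithmic cost.  Hence, for every variable ordering, the
triejoin costs at most a logarithm times the product, over the three variables, of the smaller of
the two projections that bind the variable.  On the skewed family this product is
`⌊n^{3/8}⌋ * ⌊n^{5/8}⌋ * 1`, which is also the size of the largest query result.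

The step count of NPRR is an exact expression in the heavy join keys and the light tuples.  On a
product instance all join keys have the same degree, so either all of them are heavy and `D × T`
has about `n^{5/8} * n` elements, or none is and `G ⋈ S` has about `n^{3/8} * n^{5/8} * n^{3/8}`
elements.  Both exceed every multiple of `n log n`.
-/

/-! ### Searching sorted arrays -/

/-- The keys of an array are strictly increasing. -/
def StrictSorted (keys : Array ℕ) : Prop :=
  StrictMonoOn (fun i => keys.getD i 0) (Set.Iio keys.size)

theorem getElem?_eq_some_iff_getD {keys : Array ℕ} {i x : ℕ} :
    keys[i]? = some x ↔ i < keys.size ∧ keys.getD i 0 = x := by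
  rw [Array.getElem?_eq_some_iff, Array.getD_eq_getD_getElem?]
  constructor
  · rintro ⟨h, rfl⟩
    exact ⟨h, by simp [h]⟩
  · rintro ⟨h, rfl⟩
    exact ⟨h, by simp [h]⟩

/-- The positions in `[lo, hi]` that qualify as the outcome of a search for `x`: those that hold a
key `≥ x`, and `hi` itself, which stands for the absence of such a key. -/
def searchTargets (keys : Array ℕ) (x lo hi : ℕ) : Set ℕ :=
  {i | i ∈ Set.Icc lo hi ∧ (i = hi ∨ x ≤ keys.getD i 0)}

section Searching

variable {keys : Array ℕ} {x lo hi m : ℕ}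

theorem searchTargets_eq_of_getD_lt (hs : StrictSorted keys) (hlo : lo ≤ m) (hm : m < hi)
    (hhi : hi ≤ keys.size) (hx : keys.getD m 0 < x) :
    searchTargets keys x lo hi = searchTargets keys x (m + 1) hi := by
  ext i
  refine ⟨fun ⟨hi', htarget⟩ => ⟨⟨?_, hi'.2⟩, htarget⟩,
    fun ⟨hi', htarget⟩ => ⟨⟨by grind, hi'.2⟩, htarget⟩⟩
  by_contra! him
  have hle : keys.getD i 0 ≤ keys.getD m 0 :=
    hs.monotoneOn (Set.mem_Iio.2 (by omega)) (Set.mem_Iio.2 (by omega)) (by omega)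
  omega

theorem isLeast_searchTargets_of_le_getD (hm : m ≤ hi) (hx : m = hi ∨ x ≤ keys.getD m 0) {p : ℕ}
    (hp : IsLeast (searchTargets keys x lo m) p) : IsLeast (searchTargets keys x lo hi) p := by
  obtain ⟨⟨⟨hlo, hpm⟩, hpx⟩, hleast⟩ := hp
  refine ⟨⟨⟨hlo, hpm.trans hm⟩, by grind⟩, fun i ⟨hi', htarget⟩ => ?_⟩
  rcases le_or_gt i m with him | him
  · exact hleast ⟨⟨hi'.1, him⟩, by grind⟩
  · omega

theorem bsearch_isLeast (hs : StrictSorted keys) (hlo : lo ≤ hi) (hhi : hi ≤ keys.size) :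
    IsLeast (searchTargets keys x lo hi) (bsearch keys x lo hi).val := by
  fun_induction bsearch keys x lo hi with
  | case1 lo hi hlt hx ih =>
    rw [searchTargets_eq_of_getD_lt hs (by omega) (by omega) hhi hx]
    exact ih (by omega) hhi
  | case2 lo hi hlt hx ih =>
    exact isLeast_searchTargets_of_le_getD (by omega) (.inr (not_lt.1 hx))
      (ih (by omega) (by omega))
  | case3 lo hi hge =>
    obtain rfl : lo = hi := by omega
    exact ⟨⟨Set.left_mem_Icc.2 le_rfl, .inl rfl⟩, fun i hi' => hi'.1.1⟩

theorem gallop_isLeast (hs : StrictSorted keys) {step : ℕ} (hlo : lo ≤ keys.size) :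
    IsLeast (searchTargets keys x lo keys.size) (gallop keys x lo step).val := by
  fun_induction gallop keys x lo step with
  | case1 lo step hprobe ih =>
    rw [searchTargets_eq_of_getD_lt hs (by omega) hprobe.1 le_rfl hprobe.2]
    exact ih (by omega)
  | case2 lo step hprobe =>
    exact isLeast_searchTargets_of_le_getD (m := min (lo + step) keys.size) (by omega) (by grind)
      (bsearch_isLeast hs (by omega) (by omega))

theorem bsearch_time_le {k : ℕ} (h : hi - lo < 2 ^ k) : (bsearch keys x lo hi).time ≤ k := by
  fun_induction bsearch keys x lo hi generalizing k with
  | case1 lo hi hlt _ ih =>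
    obtain _ | k := k
    · omega
    · have := ih (k := k) (by omega)
      simp only [Timed.delay]
      omega
  | case2 lo hi hlt _ ih =>
    obtain _ | k := k
    · omega
    · have := ih (k := k) (by omega)
      simp only [Timed.delay]
      omega
  | case3 lo hi _ => exact Nat.zero_le k

theorem gallop_time_le {step k l : ℕ} (hk : keys.size < 2 ^ k) (hl : keys.size ≤ 2 ^ l * step) :
    (gallop keys x lo step).time ≤ k + 1 + l := by
  fun_induction gallop keys x lo step generalizing l with
  | case1 lo step hprobe ih =>
    obtain _ | l := l
    · omega
    · have := ih (l := l) (by rwa [pow_succ, mul_assoc] at hl)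
      simp only [Timed.delay]
      omega
  | case2 lo step _ =>
    have : (bsearch keys x lo (min (lo + step) keys.size)).time ≤ k := bsearch_time_le (by omega)
    simp only [Timed.delay]
    omega

end Searching

namespace Iter

/-- The entries (position, key) that an iterator has not yet passed, the current one included. -/
def ahead (i : Iter) : Set (ℕ × ℕ) := {e | i.pos ≤ e.1 ∧ i.keys[e.1]? = some e.2}

variable {i : Iter} {e : ℕ × ℕ} {x : ℕ}

theorem ahead_eq_empty (h : i.atEnd) : i.ahead = ∅ := by
  refine Set.eq_empty_of_forall_notMem fun e he => ?_
  have := (getElem?_eq_some_iff_getD.1 he.2).1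
  exact absurd (h.trans he.1) (by omega)

theorem getElem?_pos (h : ¬ i.atEnd) : i.keys[i.pos]? = some i.key :=
  getElem?_eq_some_iff_getD.2 ⟨not_le.1 h, rfl⟩

theorem key_le_of_mem_ahead (hs : StrictSorted i.keys) (he : e ∈ i.ahead) : i.key ≤ e.2 := by
  obtain ⟨hlt, hkey⟩ := getElem?_eq_some_iff_getD.1 he.2
  exact (hs.monotoneOn (Set.mem_Iio.2 (he.1.trans_lt hlt)) hlt he.1).trans_eq hkey

theorem eq_of_mem_ahead_of_snd_eq (hs : StrictSorted i.keys) {f : ℕ × ℕ} (he : e ∈ i.ahead)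
    (hf : f ∈ i.ahead) (h : e.2 = f.2) : e = f := by
  obtain ⟨hlt, hkey⟩ := getElem?_eq_some_iff_getD.1 he.2
  obtain ⟨hlt', hkey'⟩ := getElem?_eq_some_iff_getD.1 hf.2
  exact Prod.ext (hs.injOn hlt hlt' (hkey.trans (h.trans hkey'.symm))) h

theorem ahead_eq_insert (h : ¬ i.atEnd) : i.ahead = insert (i.pos, i.key) i.next.val.ahead := by
  ext ⟨j, y⟩
  have hpos := getElem?_pos h
  simp only [ahead, next, Set.mem_ofPred_eq, Set.mem_insert_iff, Prod.mk.injEq]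
  grind

theorem ahead_seek (hs : StrictSorted i.keys) :
    (i.seek x).val.ahead = {e ∈ i.ahead | x ≤ e.2} := by
  ext ⟨j, y⟩
  have hle : i.pos ≤ (i.seek x).val.pos := le_gallop _ _ _ _
  have hleast (hpos : i.pos ≤ i.keys.size) :
      IsLeast (searchTargets i.keys x i.pos i.keys.size) (i.seek x).val.pos :=
    gallop_isLeast hs hpos
  constructor
  · rintro ⟨hj, hget⟩
    have hlt : j < i.keys.size := (getElem?_eq_some_iff_getD.1 hget).1
    obtain ⟨-, hend | hx⟩ := (hleast (by omega)).1
    · omega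
    · have hkey := key_le_of_mem_ahead (i := (i.seek x).val) hs ⟨hj, hget⟩
      exact ⟨⟨hle.trans hj, hget⟩, hx.trans hkey⟩
  · rintro ⟨⟨hj, hget⟩, hx⟩
    obtain ⟨hlt, hkey⟩ := getElem?_eq_some_iff_getD.1 hget
    exact ⟨(hleast (by omega)).2 ⟨⟨hj, hlt.le⟩, .inr (hx.trans_eq hkey.symm)⟩, hget⟩

theorem le_key_seek (hs : StrictSorted i.keys) (h : ¬ (i.seek x).val.atEnd) :
    x ≤ (i.seek x).val.key := by
  have hmem : ((i.seek x).val.pos, (i.seek x).val.key) ∈ (i.seek x).val.ahead :=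
    ⟨le_rfl, getElem?_pos h⟩
  rw [ahead_seek hs] at hmem
  exact hmem.2

theorem remaining_next_lt (h : ¬ i.atEnd) : i.next.val.remaining < i.remaining := by
  simp only [remaining, next, atEnd] at *
  omega

theorem remaining_seek_lt (hx : i.key < x) (h : ¬ (i.seek x).val.atEnd) :
    (i.seek x).val.remaining < i.remaining := by
  have hle := le_gallop i.keys x i.pos 1
  have hlt := lt_gallop i.keys x i.pos
  simp only [remaining, seek, atEnd, key] at *
  omega

theorem seek_time_le {k : ℕ} (hk : i.keys.size < 2 ^ k) : (i.seek x).time ≤ 2 * k + 1 := by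
  have : (i.seek x).time ≤ k + 1 + k := gallop_time_le hk (by omega)
  omega

end Iter

/-! ### Correctness of the leapfrog join -/

namespace Leapfrog

theorem sub_one_eq_add_one (p : Fin 2) : p - 1 = p + 1 := by decide +revert

theorem add_one_add_one (p : Fin 2) : p + 1 + 1 = p := by decide +revert

theorem forall_fin_two_iff (p : Fin 2) {P : Fin 2 → Prop} : (∀ i, P i) ↔ P p ∧ P (p + 1) := by
  revert p
  simp [Fin.forall_fin_two, and_comm]

theorem atEnd_iff (s : Leapfrog) : s.atEnd ↔ ∃ i, (s.iter i).atEnd := by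
  simp only [atEnd, Fin.exists_fin_two]

theorem not_atEnd_iff (s : Leapfrog) : ¬ s.atEnd ↔ ∀ i, ¬ (s.iter i).atEnd := by
  rw [atEnd_iff, not_exists]

/-- Both arrays of a leapfrog join are strictly sorted. -/
def Sorted (s : Leapfrog) : Prop := ∀ i, StrictSorted (s.iter i).keys

/-- The matches that a leapfrog join has not yet passed: positions in the two arrays, together with
the key found at both of them. -/
def pendingMatches (s : Leapfrog) : Set ((Fin 2 → ℕ) × ℕ) :=
  {m | ∀ i, (m.1 i, m.2) ∈ (s.iter i).ahead}

/-- The condition in which leapfrog-search leaves a join: at its end, or with both iterators at the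
same key. -/
def Settled (s : Leapfrog) : Prop := s.atEnd ∨ ∀ i, (s.iter i).key = (s.iter s.p).key

variable {s : Leapfrog} {it : Iter}

theorem Sorted.of_keys_eq {t : Leapfrog} (hs : s.Sorted)
    (h : ∀ i, (t.iter i).keys = (s.iter i).keys) : t.Sorted :=
  fun i => (h i).symm ▸ hs i

theorem pendingMatches_eq_empty (h : s.atEnd) : s.pendingMatches = ∅ := by
  obtain ⟨i, hi⟩ := s.atEnd_iff.1 h
  refine Set.eq_empty_of_forall_notMem fun m hm => ?_
  simpa only [Iter.ahead_eq_empty hi, Set.mem_empty_iff_false] using hm i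

section SetCur

@[simp] theorem setCur_iter_self : (s.setCur it).iter s.p = it := by
  simp only [setCur, Function.update_self]

@[simp] theorem setCur_iter_add_one : (s.setCur it).iter (s.p + 1) = s.iter (s.p + 1) := by
  simp [setCur]

theorem setCur_keys (h : it.keys = (s.iter s.p).keys) (i : Fin 2) :
    ((s.setCur it).iter i).keys = (s.iter i).keys := by
  revert i
  simp only [forall_fin_two_iff s.p, setCur_iter_self, setCur_iter_add_one, h, and_self]

theorem Sorted.setCur_advance (hs : s.Sorted) (h : it.keys = (s.iter s.p).keys) :
    (s.setCur it).advance.Sorted := hs.of_keys_eq (setCur_keys h)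

theorem atEnd_setCur (h : it.atEnd) : (s.setCur it).atEnd :=
  (atEnd_iff _).2 ⟨s.p, by rwa [setCur_iter_self]⟩

theorem not_atEnd_setCur (hs : ¬ s.atEnd) (h : ¬ it.atEnd) : ¬ (s.setCur it).atEnd := by
  rw [not_atEnd_iff, forall_fin_two_iff s.p] at hs ⊢
  rw [setCur_iter_self, setCur_iter_add_one]
  exact ⟨h, hs.2⟩

theorem mem_pendingMatches_setCur {m : (Fin 2 → ℕ) × ℕ} :
    m ∈ (s.setCur it).pendingMatches ↔
      (m.1 s.p, m.2) ∈ it.ahead ∧ (m.1 (s.p + 1), m.2) ∈ (s.iter (s.p + 1)).ahead := by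
  simp only [pendingMatches, Set.mem_ofPred_eq, forall_fin_two_iff s.p, setCur_iter_self,
    setCur_iter_add_one]

theorem pendingMatches_setCur_seek (hs : s.Sorted) :
    (s.setCur ((s.iter s.p).seek (s.iter (s.p + 1)).key).val).pendingMatches =
      s.pendingMatches := by
  ext m
  rw [mem_pendingMatches_setCur, Iter.ahead_seek (hs s.p)]
  refine Iff.trans ?_ (forall_fin_two_iff s.p).symm
  exact ⟨fun ⟨⟨h, _⟩, h'⟩ => ⟨h, h'⟩,
    fun ⟨h, h'⟩ =>
    ⟨⟨h, Iter.key_le_of_mem_ahead (e := (m.1 (s.p + 1), m.2)) (hs (s.p + 1)) h'⟩, h'⟩⟩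

theorem pendingMatches_eq_insert_setCur_next (hs : s.Sorted) (hend : ¬ s.atEnd)
    (hkey : ∀ i, (s.iter i).key = (s.iter s.p).key) :
    s.pendingMatches = insert (fun i => (s.iter i).pos, (s.iter s.p).key)
      (s.setCur (s.iter s.p).next.val).pendingMatches := by
  have hcur (i : Fin 2) : ((s.iter i).pos, (s.iter s.p).key) ∈ (s.iter i).ahead :=
    ⟨le_rfl, hkey i ▸ Iter.getElem?_pos (s.not_atEnd_iff.1 hend i)⟩
  have hahead := Iter.ahead_eq_insert (s.not_atEnd_iff.1 hend s.p)
  ext m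
  rw [Set.mem_insert_iff, mem_pendingMatches_setCur]
  constructor
  · intro hm
    refine or_iff_not_imp_right.2 fun hnext => ?_
    have hp : (m.1 s.p, m.2) = ((s.iter s.p).pos, (s.iter s.p).key) := by
      have hmp := hm s.p
      rw [hahead] at hmp
      exact hmp.resolve_right fun h => hnext ⟨h, hm _⟩
    have hm2 : m.2 = (s.iter s.p).key := congrArg Prod.snd hp
    refine Prod.ext (funext fun i => ?_) hm2
    exact congrArg Prod.fst (Iter.eq_of_mem_ahead_of_snd_eq (hs i) (hm i) (hcur i) hm2)
  · rintro (rfl | ⟨hp, hp'⟩)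
    · exact hcur
    · exact (forall_fin_two_iff s.p).2 ⟨hahead ▸ Set.mem_insert_of_mem _ hp, hp'⟩

end SetCur

theorem keys_search (s : Leapfrog) (i : Fin 2) :
    ((search s).val.iter i).keys = (s.iter i).keys := by
  fun_induction search s with
  | case1 s => rfl
  | case2 s _ _ _ r => exact setCur_keys (it := r.val) rfl i
  | case3 s _ _ _ r _ ih => exact ih.trans (setCur_keys (it := r.val) rfl i)

theorem pendingMatches_search (hs : s.Sorted) :
    (search s).val.pendingMatches = s.pendingMatches := by
  fun_induction search s with
  | case1 s => rfl
  | case2 s _ _ _ _ =>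
    have hseek := pendingMatches_setCur_seek hs
    rwa [← sub_one_eq_add_one] at hseek
  | case3 s _ _ _ r _ ih =>
    have hseek := pendingMatches_setCur_seek hs
    rw [← sub_one_eq_add_one] at hseek
    exact (ih (hs.setCur_advance (it := r.val) rfl)).trans hseek

theorem settled_search (hs : s.Sorted) (hkey : (s.iter s.p).key ≤ (s.iter (s.p + 1)).key) :
    (search s).val.Settled := by
  fun_induction search s with
  | case1 s _ _ hx =>
    rw [← sub_one_eq_add_one] at hkey
    refine .inr ((forall_fin_two_iff s.p).2 ⟨rfl, ?_⟩)
    rw [← sub_one_eq_add_one]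
    exact le_antisymm hx hkey
  | case2 s _ _ _ r he => exact .inl (atEnd_setCur he)
  | case3 s _ _ _ r he ih =>
    refine ih (hs.setCur_advance (it := r.val) rfl) ?_
    change ((s.setCur r.val).iter (s.p + 1)).key ≤ ((s.setCur r.val).iter (s.p + 1 + 1)).key
    rw [add_one_add_one, setCur_iter_self, setCur_iter_add_one, ← sub_one_eq_add_one]
    exact Iter.le_key_seek (hs s.p) he

theorem next_of_atEnd (h : (s.iter s.p).next.val.atEnd) :
    s.next = ⟨s.setCur (s.iter s.p).next.val, 2⟩ := if_pos h

theorem next_of_not_atEnd (h : ¬ (s.iter s.p).next.val.atEnd) :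
    s.next = (search (s.setCur (s.iter s.p).next.val).advance).delay 2 := if_neg h

theorem keys_next (s : Leapfrog) (i : Fin 2) : (s.next.val.iter i).keys = (s.iter i).keys := by
  have hkeys := setCur_keys (s := s) (it := (s.iter s.p).next.val) rfl i
  by_cases h : (s.iter s.p).next.val.atEnd
  · rwa [next_of_atEnd h]
  · rw [next_of_not_atEnd h]
    exact (keys_search _ i).trans hkeys

theorem pendingMatches_eq_insert_next (hs : s.Sorted) (hend : ¬ s.atEnd)
    (hkey : ∀ i, (s.iter i).key = (s.iter s.p).key) :
    s.pendingMatches =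
      insert (fun i => (s.iter i).pos, (s.iter s.p).key) s.next.val.pendingMatches := by
  rw [pendingMatches_eq_insert_setCur_next hs hend hkey]
  by_cases h : (s.iter s.p).next.val.atEnd
  · rw [next_of_atEnd h]
  · rw [next_of_not_atEnd h]
    exact congrArg _
      (pendingMatches_search (hs.setCur_advance (it := (s.iter s.p).next.val) rfl)).symm

theorem settled_next (hs : s.Sorted) (hkey : ∀ i, (s.iter i).key = (s.iter s.p).key) :
    s.next.val.Settled := by
  by_cases h : (s.iter s.p).next.val.atEnd
  · rw [next_of_atEnd h]
    exact .inl (atEnd_setCur h)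
  · rw [next_of_not_atEnd h]
    refine settled_search (hs.setCur_advance rfl) ?_
    change ((s.setCur _).iter (s.p + 1)).key ≤ ((s.setCur _).iter (s.p + 1 + 1)).key
    rw [add_one_add_one, setCur_iter_self, setCur_iter_add_one, hkey]
    have hlt : (s.iter s.p).pos + 1 < (s.iter s.p).keys.size := not_le.1 h
    exact (hs s.p (Set.mem_Iio.2 (by omega)) hlt (Nat.lt_succ_self _)).le

theorem mem_forEach {β : Type} {body : ℕ → ℕ → ℕ → Timed (List β)} {z : β} (hs : s.Sorted)
    (h : s.Settled) :
    z ∈ (forEach (fun s => body (s.iter 0).pos (s.iter 1).pos (s.iter 0).key) s).val ↔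
      ∃ m ∈ s.pendingMatches, z ∈ (body (m.1 0) (m.1 1) m.2).val := by
  generalize hB : (fun s : Leapfrog => body (s.iter 0).pos (s.iter 1).pos (s.iter 0).key) = B
  fun_induction forEach B s with
  | case1 s he => simp only [pendingMatches_eq_empty he, List.not_mem_nil, Set.mem_empty_iff_false,
      false_and, exists_false]
  | case2 s he r s' rest ih =>
    have hkey := h.resolve_left he
    rw [List.mem_append, ih (hs.of_keys_eq (keys_next s)) (settled_next hs hkey),
      pendingMatches_eq_insert_next hs he hkey, Set.exists_mem_insert]
    simp only [r, s', ← hB, hkey 0]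

/-- The state in which leapfrog-init starts its search. -/
def initState (A B : Array ℕ) : Leapfrog :=
  ⟨![⟨A, 0⟩, ⟨B, 0⟩], if A.getD 0 0 ≤ B.getD 0 0 then 0 else 1⟩

theorem init_of_atEnd {A B : Array ℕ} (h : (initState A B).atEnd) :
    init A B = ⟨initState A B, 1⟩ := if_pos h

theorem init_of_not_atEnd {A B : Array ℕ} (h : ¬ (initState A B).atEnd) :
    init A B = (search (initState A B)).delay 2 := if_neg h

theorem initState_keys (A B : Array ℕ) (i : Fin 2) : ((initState A B).iter i).keys = ![A, B] i := by
  fin_cases i <;> rfl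

theorem init_keys (A B : Array ℕ) (i : Fin 2) : ((init A B).val.iter i).keys = ![A, B] i := by
  by_cases h : (initState A B).atEnd
  · rw [init_of_atEnd h, initState_keys]
  · rw [init_of_not_atEnd h]
    exact (keys_search _ i).trans (initState_keys A B i)

section Level

variable {A B : Array ℕ}

theorem sorted_initState (hA : StrictSorted A) (hB : StrictSorted B) : (initState A B).Sorted := by
  intro i
  fin_cases i
  · exact hA
  · exact hB

theorem mem_pendingMatches_initState {m : (Fin 2 → ℕ) × ℕ} :
    m ∈ (initState A B).pendingMatches ↔ A[m.1 0]? = some m.2 ∧ B[m.1 1]? = some m.2 := by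
  simp [pendingMatches, initState, Iter.ahead, Fin.forall_fin_two]

theorem initState_key_le :
    ((initState A B).iter (initState A B).p).key ≤
      ((initState A B).iter ((initState A B).p + 1)).key := by
  by_cases h : A.getD 0 0 ≤ B.getD 0 0
  · have hp : (initState A B).p = 0 := if_pos h
    rw [hp]
    exact h
  · have hp : (initState A B).p = 1 := if_neg h
    rw [hp]
    exact (not_le.1 h).le

theorem pendingMatches_init (hA : StrictSorted A) (hB : StrictSorted B) :
    (init A B).val.pendingMatches = (initState A B).pendingMatches := by
  by_cases h : (initState A B).atEnd
  · rw [init_of_atEnd h]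
  · rw [init_of_not_atEnd h]
    exact pendingMatches_search (sorted_initState hA hB)

theorem settled_init (hA : StrictSorted A) (hB : StrictSorted B) : (init A B).val.Settled := by
  by_cases h : (initState A B).atEnd
  · rw [init_of_atEnd h]
    exact .inl h
  · rw [init_of_not_atEnd h]
    exact settled_search (sorted_initState hA hB) initState_key_le

theorem mem_level {β : Type} {body : ℕ → ℕ → ℕ → Timed (List β)} {z : β} (hA : StrictSorted A)
    (hB : StrictSorted B) :
    z ∈ (level A B body).val ↔
      ∃ x i j, A[i]? = some x ∧ B[j]? = some x ∧ z ∈ (body i j x).val := by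
  have hs : (init A B).val.Sorted := (sorted_initState hA hB).of_keys_eq fun i => by
    rw [init_keys, initState_keys]
  refine (mem_forEach hs (settled_init hA hB)).trans ?_
  simp only [pendingMatches_init hA hB, mem_pendingMatches_initState]
  constructor
  · rintro ⟨m, ⟨hi, hj⟩, hz⟩
    exact ⟨m.2, m.1 0, m.1 1, hi, hj, hz⟩
  · rintro ⟨x, i, j, hi, hj, hz⟩
    exact ⟨(![i, j], x), ⟨hi, hj⟩, hz⟩

end Level

end Leapfrog

/-! ### Running time of the leapfrog join -/

namespace Leapfrog

open Classical in
/-- A bound on the number of moves of a leapfrog join that depends on one of its two arrays only: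
every other move advances the iterator `Iter[j]`. -/
noncomputable def potential (j : Fin 2) (s : Leapfrog) : ℕ :=
  2 * (s.iter j).remaining + (if s.p = j then 0 else 1) + (if s.atEnd then 0 else 1)

variable {s : Leapfrog} {it : Iter} {j : Fin 2} {k : ℕ}

theorem potential_setCur_advance_lt (hend : ¬ s.atEnd) (he : ¬ it.atEnd)
    (hr : it.remaining < (s.iter s.p).remaining) :
    potential j (s.setCur it).advance < potential j s := by
  have he' : ¬ (s.setCur it).advance.atEnd := not_atEnd_setCur hend he
  have hp : (s.setCur it).advance.p = s.p + 1 := rfl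
  have hiter : (s.setCur it).advance.iter = (s.setCur it).iter := rfl
  rw [potential, potential, if_neg hend, if_neg he', hp, hiter]
  revert j
  simp only [forall_fin_two_iff s.p, setCur_iter_self, setCur_iter_add_one, add_eq_left,
    left_eq_add, one_ne_zero, ↓reduceIte]
  omega

theorem potential_setCur_lt (hend : ¬ s.atEnd) (he : it.atEnd) :
    potential j (s.setCur it) < potential j s := by
  have hp : (s.setCur it).p = s.p := rfl
  have hr : it.remaining = 0 := Nat.sub_eq_zero_of_le he
  rw [potential, potential, if_neg hend, if_pos (atEnd_setCur he), hp]
  revert j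
  simp [forall_fin_two_iff s.p, hr]

theorem search_time_add_potential_le (hend : ¬ s.atEnd)
    (hk : ∀ i, (s.iter i).keys.size < 2 ^ k) :
    (search s).time + (2 * k + 2) * potential j (search s).val ≤
      (2 * k + 2) * potential j s + 1 := by
  fun_induction search s with
  | case1 s => exact (Nat.add_comm _ _).le
  | case2 s x' _ _ r he =>
    have hseek : r.time ≤ 2 * k + 1 := Iter.seek_time_le (hk _)
    have hpot := Nat.mul_le_mul_left (2 * k + 2) (potential_setCur_lt (j := j) hend he)
    rw [Nat.mul_succ] at hpot
    change 1 + r.time + (2 * k + 2) * potential j (s.setCur r.val) ≤ _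
    omega
  | case3 s x' _ hx r he ih =>
    have hseek : r.time ≤ 2 * k + 1 := Iter.seek_time_le (hk _)
    have hpot := Nat.mul_le_mul_left (2 * k + 2) (potential_setCur_advance_lt (j := j) hend he
      (Iter.remaining_seek_lt (not_le.1 hx) he))
    have hrest := ih (not_atEnd_setCur hend he) fun i =>
      (congrArg Array.size (setCur_keys (it := r.val) rfl i)).trans_lt (hk i)
    rw [Nat.mul_succ] at hpot
    simp only [Timed.delay]
    omega

theorem next_time_add_potential_le (hend : ¬ s.atEnd) (hk : ∀ i, (s.iter i).keys.size < 2 ^ k) :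
    s.next.time + (2 * k + 2) * potential j s.next.val ≤ (2 * k + 2) * potential j s + 1 := by
  by_cases he : (s.iter s.p).next.val.atEnd
  · have hpot := Nat.mul_le_mul_left (2 * k + 2) (potential_setCur_lt (j := j) hend he)
    rw [Nat.mul_succ] at hpot
    rw [next_of_atEnd he]
    simp only
    omega
  · have hpot := Nat.mul_le_mul_left (2 * k + 2) (potential_setCur_advance_lt (j := j) hend he
      (Iter.remaining_next_lt (s.not_atEnd_iff.1 hend _)))
    have hsearch := search_time_add_potential_le (j := j)
      (s := (s.setCur (s.iter s.p).next.val).advance) (not_atEnd_setCur hend he) fun i =>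
        (congrArg Array.size (setCur_keys (s := s) (it := (s.iter s.p).next.val) rfl i)).trans_lt
          (hk i)
    rw [Nat.mul_succ] at hpot
    rw [next_of_not_atEnd he]
    simp only [Timed.delay]
    omega

theorem one_le_search_time (s : Leapfrog) : 1 ≤ (search s).time := by
  fun_induction search s <;> simp only [Timed.delay] <;> omega

theorem two_le_next_time (s : Leapfrog) : 2 ≤ s.next.time := by
  by_cases he : (s.iter s.p).next.val.atEnd
  · rw [next_of_atEnd he]
  · rw [next_of_not_atEnd he]
    exact Nat.le_add_right 2 _

theorem potential_search_le (hend : ¬ s.atEnd) (hk : ∀ i, (s.iter i).keys.size < 2 ^ k) :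
    potential j (search s).val ≤ potential j s := by
  have htime := search_time_add_potential_le (j := j) hend hk
  have hone := one_le_search_time s
  exact Nat.le_of_mul_le_mul_left (by omega) (by omega : 0 < 2 * k + 2)

theorem potential_next_lt (hend : ¬ s.atEnd) (hk : ∀ i, (s.iter i).keys.size < 2 ^ k) :
    potential j s.next.val < potential j s := by
  have htime := next_time_add_potential_le (j := j) hend hk
  have htwo := two_le_next_time s
  exact lt_of_mul_lt_mul_left (by omega) (Nat.zero_le (2 * k + 2))

theorem forEach_time_le {β : Type} {body : Leapfrog → Timed (List β)} {W : ℕ}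
    (hW : ∀ s, (body s).time ≤ W) (hk : ∀ i, (s.iter i).keys.size < 2 ^ k) (j : Fin 2) :
    (forEach body s).time ≤ (W + (2 * k + 2) + 2) * potential j s + 1 := by
  fun_induction forEach body s with
  | case1 s => exact Nat.le_add_left _ _
  | case2 s hend r s' rest ih =>
    have hbody : r.time ≤ W := hW s
    have hnext : s'.time + (2 * k + 2) * potential j s'.val ≤ (2 * k + 2) * potential j s + 1 :=
      next_time_add_potential_le hend hk
    have hpot : (W + 2) * (potential j s'.val + 1) ≤ (W + 2) * potential j s :=
      Nat.mul_le_mul_left _ (potential_next_lt hend hk)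
    have hrest : rest.time ≤ (W + (2 * k + 2) + 2) * potential j s'.val + 1 :=
      ih fun i => (congrArg Array.size (keys_next s i)).trans_lt (hk i)
    simp only
    linarith

section Level

variable {A B : Array ℕ}

theorem potential_initState_le : potential j (initState A B) ≤ 2 * (![A, B] j).size + 2 := by
  have hr : ((initState A B).iter j).remaining = (![A, B] j).size := by
    rw [Iter.remaining, initState_keys]
    fin_cases j <;> rfl
  unfold potential
  split_ifs <;> omega

theorem init_time_le (hk : ∀ i, ((initState A B).iter i).keys.size < 2 ^ k) (j : Fin 2) :
    (init A B).time ≤ (2 * k + 2) * potential j (initState A B) + 3 := by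
  by_cases h : (initState A B).atEnd
  · rw [init_of_atEnd h]
    exact Nat.le_add_left_of_le (by norm_num)
  · have := search_time_add_potential_le (j := j) h hk
    rw [init_of_not_atEnd h]
    simp only [Timed.delay]
    omega

theorem potential_init_le (hk : ∀ i, ((initState A B).iter i).keys.size < 2 ^ k) :
    potential j (init A B).val ≤ potential j (initState A B) := by
  by_cases h : (initState A B).atEnd
  · rw [init_of_atEnd h]
  · rw [init_of_not_atEnd h]
    exact potential_search_le h hk

theorem level_time_le {β : Type} {body : ℕ → ℕ → ℕ → Timed (List β)} {W m : ℕ}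
    (hA : A.size < 2 ^ k) (hB : B.size < 2 ^ k) (hm : min A.size B.size ≤ m) (hW : 1 ≤ W)
    (hbody : ∀ i j x, (body i j x).time ≤ W * (k + 1)) :
    (level A B body).time ≤ 22 * ((m + 1) * W) * (k + 1) := by
  obtain ⟨j, hj⟩ : ∃ j : Fin 2, (![A, B] j).size ≤ m := by
    simpa [Fin.exists_fin_two, min_le_iff] using hm
  have hsize (i : Fin 2) : (![A, B] i).size < 2 ^ k := by
    fin_cases i
    · exact hA
    · exact hB
  have hk (i : Fin 2) : ((initState A B).iter i).keys.size < 2 ^ k := by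
    rw [initState_keys]
    exact hsize i
  have hpot : potential j (initState A B) ≤ 2 * m + 2 := potential_initState_le.trans (by omega)
  have hinit : (init A B).time ≤ (2 * k + 2) * (2 * m + 2) + 3 :=
    (init_time_le hk j).trans (by gcongr)
  have hkeys (i : Fin 2) : ((init A B).val.iter i).keys.size < 2 ^ k := by
    rw [init_keys]
    exact hsize i
  have hloop : (forEach (fun s => body (s.iter 0).pos (s.iter 1).pos (s.iter 0).key)
      (init A B).val).time ≤ (W * (k + 1) + (2 * k + 2) + 2) * (2 * m + 2) + 1 :=
    (forEach_time_le (fun _ => hbody _ _ _) hkeys j).trans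
      (by gcongr; exact (potential_init_le hk).trans hpot)
  have hW' : (m + 1) * (k + 1) ≤ W * ((m + 1) * (k + 1)) := Nat.le_mul_of_pos_left _ hW
  calc (level A B body).time
      ≤ 2 + ((2 * k + 2) * (2 * m + 2) + 3) +
          ((W * (k + 1) + (2 * k + 2) + 2) * (2 * m + 2) + 1) + 2 := by
        simp only [level]
        gcongr
    _ ≤ 2 * (W * ((m + 1) * (k + 1))) + 20 * ((m + 1) * (k + 1)) := by nlinarith
    _ ≤ 22 * ((m + 1) * W) * (k + 1) := by linarith

end Level

end Leapfrog

/-! ### Leapfrog triejoin -/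

theorem strictSorted_sort (s : Finset ℕ) : StrictSorted (s.sort (· ≤ ·)).toArray := by
  intro i hi j hj hij
  have hi' : i < s.card := by simpa using hi
  have hj' : j < s.card := by simpa using hj
  have hlt := (Finset.sortedLT_sort s).strictMono_get (a := ⟨i, by simpa using hi'⟩)
    (b := ⟨j, by simpa using hj'⟩) hij
  simpa [Array.getD, hi', hj'] using hlt

theorem exists_getElem?_sort_iff {s : Finset ℕ} {x : ℕ} :
    (∃ i : ℕ, (s.sort (· ≤ ·)).toArray[i]? = some x) ↔ x ∈ s := by
  rw [← Array.mem_iff_getElem?, List.mem_toArray, Finset.mem_sort]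

theorem mem_projFst {E : Finset (ℕ × ℕ)} {x y : ℕ} (h : (x, y) ∈ E) : x ∈ projFst E :=
  Finset.mem_image_of_mem Prod.fst h

theorem mem_projSnd {E : Finset (ℕ × ℕ)} {x y : ℕ} (h : (x, y) ∈ E) : y ∈ projSnd E :=
  Finset.mem_image_of_mem Prod.snd h

namespace Trie

variable {E F G : Finset (ℕ × ℕ)} {i x y z k : ℕ}

theorem strictSorted_keys (E : Finset (ℕ × ℕ)) : StrictSorted (ofRel E).keys :=
  strictSorted_sort _

theorem exists_keys_getElem?_iff : (∃ i : ℕ, (ofRel E).keys[i]? = some x) ↔ x ∈ projFst E :=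
  exists_getElem?_sort_iff

theorem size_keys (E : Finset (ℕ × ℕ)) : (ofRel E).keys.size = (projFst E).card := by
  simp [ofRel]

theorem openAt_ofRel (h : (ofRel E).keys[i]? = some x) :
    (ofRel E).openAt i =
      ((projSnd (E.filter fun e => e.1 = x)).sort (· ≤ ·)).toArray := by
  have hget : ((projFst E).sort (· ≤ ·))[i]? = some x := by simpa [ofRel] using h
  simp [openAt, ofRel, hget]

theorem strictSorted_openAt (h : (ofRel E).keys[i]? = some x) :
    StrictSorted ((ofRel E).openAt i) := by
  rw [openAt_ofRel h]
  exact strictSorted_sort _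

theorem exists_openAt_getElem?_iff (h : (ofRel E).keys[i]? = some x) :
    (∃ j : ℕ, ((ofRel E).openAt i)[j]? = some y) ↔ (x, y) ∈ E := by
  rw [openAt_ofRel h, exists_getElem?_sort_iff]
  simp [projSnd]

theorem size_openAt_le (E : Finset (ℕ × ℕ)) (i : ℕ) :
    ((ofRel E).openAt i).size ≤ (projSnd E).card := by
  rcases h : (ofRel E).keys[i]? with _ | x
  · have hget : ((projFst E).sort (· ≤ ·))[i]? = none := by simpa [ofRel] using h
    simp [openAt, ofRel, hget]
  · rw [openAt_ofRel h, List.size_toArray, Finset.length_sort]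
    exact Finset.card_le_card (Finset.image_subset_image (Finset.filter_subset _ _))

theorem mem_triejoin :
    (x, y, z) ∈ (triejoin (ofRel E) (ofRel F) (ofRel G)).val ↔
      (x, y) ∈ E ∧ (y, z) ∈ F ∧ (x, z) ∈ G := by
  unfold triejoin
  rw [Leapfrog.mem_level (strictSorted_keys E) (strictSorted_keys G)]
  constructor
  · rintro ⟨x', i, k, hi, hk, h⟩
    rw [Leapfrog.mem_level (strictSorted_openAt hi) (strictSorted_keys F)] at h
    obtain ⟨y', l, j, hl, hj, h⟩ := h
    rw [Leapfrog.mem_level (strictSorted_openAt hj) (strictSorted_openAt hk)] at h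
    obtain ⟨z', u, v, hu, hv, h⟩ := h
    obtain ⟨rfl, rfl, rfl⟩ : x = x' ∧ y = y' ∧ z = z' := by
      simpa only [List.mem_singleton, Prod.mk.injEq] using h
    exact ⟨(exists_openAt_getElem?_iff hi).1 ⟨l, hl⟩, (exists_openAt_getElem?_iff hj).1 ⟨u, hu⟩,
      (exists_openAt_getElem?_iff hk).1 ⟨v, hv⟩⟩
  · rintro ⟨hE, hF, hG⟩
    obtain ⟨i, hi⟩ := exists_keys_getElem?_iff.2 (mem_projFst hE)
    obtain ⟨k, hk⟩ := exists_keys_getElem?_iff.2 (mem_projFst hG)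
    obtain ⟨j, hj⟩ := exists_keys_getElem?_iff.2 (mem_projFst hF)
    obtain ⟨l, hl⟩ := (exists_openAt_getElem?_iff hi).2 hE
    obtain ⟨u, hu⟩ := (exists_openAt_getElem?_iff hj).2 hF
    obtain ⟨v, hv⟩ := (exists_openAt_getElem?_iff hk).2 hG
    refine ⟨x, i, k, hi, hk, ?_⟩
    rw [Leapfrog.mem_level (strictSorted_openAt hi) (strictSorted_keys F)]
    refine ⟨y, l, j, hl, hj, ?_⟩
    rw [Leapfrog.mem_level (strictSorted_openAt hj) (strictSorted_openAt hk)]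
    exact ⟨z, u, v, hu, hv, List.mem_singleton_self _⟩

theorem triejoin_time_le (hE : E.card < 2 ^ k) (hF : F.card < 2 ^ k) (hG : G.card < 2 ^ k) :
    (triejoin (ofRel E) (ofRel F) (ofRel G)).time ≤
      22 ^ 3 * ((min (projFst E).card (projFst G).card + 1) *
        ((min (projSnd E).card (projFst F).card + 1) *
          (min (projSnd F).card (projSnd G).card + 1))) * (k + 1) := by
  have hkeys {H : Finset (ℕ × ℕ)} (hH : H.card < 2 ^ k) : (ofRel H).keys.size < 2 ^ k :=
    (size_keys H).trans_le Finset.card_image_le |>.trans_lt hH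
  have hopen {H : Finset (ℕ × ℕ)} (hH : H.card < 2 ^ k) (i : ℕ) :
      ((ofRel H).openAt i).size < 2 ^ k :=
    (size_openAt_le H i).trans Finset.card_image_le |>.trans_lt hH
  have hlast (i j : ℕ) (f : ℕ → ℕ × ℕ × ℕ) :
      (Leapfrog.level ((ofRel F).openAt j) ((ofRel G).openAt i)
        fun _ _ z => ⟨[f z], 1⟩).time ≤
        22 * ((min (projSnd F).card (projSnd G).card + 1) * 1) * (k + 1) :=
    Leapfrog.level_time_le (hopen hF j) (hopen hG i)
      (min_le_min (size_openAt_le F j) (size_openAt_le G i)) le_rfl (fun _ _ _ => by simp)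
  have hlast_pos : 1 ≤ 22 * ((min (projSnd F).card (projSnd G).card + 1) * 1) := by omega
  refine (Leapfrog.level_time_le (hkeys hE) (hkeys hG) (by rw [size_keys, size_keys]) ?_
    fun i k x => Leapfrog.level_time_le (hopen hE i) (hkeys hF)
      (min_le_min (size_openAt_le E i) (size_keys F).le) hlast_pos
        fun _ j y => hlast k j fun z => (x, y, z)).trans ?_
  · exact Nat.mul_pos (by norm_num) (Nat.mul_pos (Nat.succ_pos _) hlast_pos)
  · exact le_of_eq (by ring)

end Trie

/-! ### Variable orderings -/

theorem forall_ne_fin_three_iff {P : Fin 3 → Fin 3 → Prop} (hP : ∀ i j, P i j ↔ P j i) :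
    (∀ i j, i ≠ j → P i j) ↔ P 0 1 ∧ P 1 2 ∧ P 0 2 := by
  constructor
  · intro h
    exact ⟨h 0 1 (by decide), h 1 2 (by decide), h 0 2 (by decide)⟩
  · rintro ⟨h01, h12, h02⟩ i j hij
    have h10 := (hP 0 1).1 h01
    have h21 := (hP 1 2).1 h12
    have h20 := (hP 0 2).1 h02
    fin_cases i <;> fin_cases j <;> first | contradiction | assumption

namespace TriDB

variable {A : TriDB} {v : Fin 3 → ℕ} {σ : Equiv.Perm (Fin 3)} {i j k : Fin 3}

theorem mem_atom_swap {x y : ℕ} : (x, y) ∈ A.atom i j ↔ (y, x) ∈ A.atom j i := by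
  fin_cases i <;> fin_cases j <;> simp [atom]

theorem mem_result_iff_atom :
    (v 0, v 1, v 2) ∈ A.result ↔ ∀ i j, i ≠ j → (v i, v j) ∈ A.atom i j := by
  rw [A.mem_result, forall_ne_fin_three_iff fun i j => mem_atom_swap]
  rfl

theorem mem_result_iff_perm :
    (v 0, v 1, v 2) ∈ A.result ↔ (v (σ 0), v (σ 1)) ∈ A.atom (σ 0) (σ 1) ∧
      (v (σ 1), v (σ 2)) ∈ A.atom (σ 1) (σ 2) ∧ (v (σ 0), v (σ 2)) ∈ A.atom (σ 0) (σ 2) := by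
  refine mem_result_iff_atom.trans (Iff.trans ?_ (forall_ne_fin_three_iff
    (P := fun i j => (v (σ i), v (σ j)) ∈ A.atom (σ i) (σ j)) fun _ _ => mem_atom_swap))
  refine ⟨fun h i j hij => h _ _ (σ.injective.ne hij), fun h i j hij => ?_⟩
  simpa using h (σ.symm i) (σ.symm j) (σ.symm.injective.ne hij)

theorem projSnd_atom : projSnd (A.atom i j) = projFst (A.atom j i) := by
  ext x
  simp only [projFst, projSnd, Finset.mem_image, Prod.exists, exists_and_right, exists_eq_right,
    mem_atom_swap (i := i)]

theorem card_atom_le (A : TriDB) (i j : Fin 3) : (A.atom i j).card ≤ A.maxCard := by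
  have hR : A.R.card ≤ A.maxCard := le_max_left _ _
  have hS : A.S.card ≤ A.maxCard := le_max_of_le_right (le_max_left _ _)
  have hT : A.T.card ≤ A.maxCard := le_max_of_le_right (le_max_right _ _)
  fin_cases i <;> fin_cases j <;>
    simp [atom, Finset.card_image_of_injective, Prod.swap_injective, hR, hS, hT]

/-- For each variable, the size of the smaller one of the two projections that bind it. -/
def varBound (A : TriDB) : Fin 3 → ℕ :=
  ![min (projFst A.R).card (projFst A.T).card, min (projSnd A.R).card (projFst A.S).card,
    min (projSnd A.S).card (projSnd A.T).card]

theorem min_card_projFst_atom (hij : i ≠ j) (hik : i ≠ k) (hjk : j ≠ k) :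
    min (projFst (A.atom i j)).card (projFst (A.atom i k)).card = A.varBound i := by
  have hswap (E : Finset (ℕ × ℕ)) : projFst (E.image Prod.swap) = projSnd E := by
    simp [projFst, projSnd, Finset.image_image, Function.comp_def]
  fin_cases i <;> fin_cases j <;> fin_cases k <;> first
    | contradiction
    | simp [hswap, varBound, atom, min_comm]

theorem card_result_le_prod_varBound (A : TriDB) : A.result.card ≤ ∏ i, A.varBound i := by
  have hsub : A.result ⊆ (projFst A.R ∩ projFst A.T) ×ˢ (projSnd A.R ∩ projFst A.S) ×ˢ
      (projSnd A.S ∩ projSnd A.T) := by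
    rintro ⟨a, b, c⟩ h
    obtain ⟨hR, hS, hT⟩ := (A.mem_result a b c).1 h
    simp only [Finset.mem_product, Finset.mem_inter]
    exact ⟨⟨mem_projFst hR, mem_projFst hT⟩, ⟨mem_projSnd hR, mem_projFst hS⟩,
      mem_projSnd hS, mem_projSnd hT⟩
  have hinter (X Y : Finset ℕ) : (X ∩ Y).card ≤ min X.card Y.card :=
    le_min (Finset.card_le_card Finset.inter_subset_left)
      (Finset.card_le_card Finset.inter_subset_right)
  refine (Finset.card_le_card hsub).trans ?_
  rw [Finset.card_product, Finset.card_product, Fin.prod_univ_three, mul_assoc]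
  exact Nat.mul_le_mul (hinter _ _) (Nat.mul_le_mul (hinter _ _) (hinter _ _))

end TriDB

theorem mem_leapfrogTriejoin {σ : Equiv.Perm (Fin 3)} {A : TriDB} {v : Fin 3 → ℕ} :
    (v 0, v 1, v 2) ∈ (leapfrogTriejoin σ A).val ↔ (v 0, v 1, v 2) ∈ A.result := by
  rw [TriDB.mem_result_iff_perm (σ := σ), ← Trie.mem_triejoin]
  simp only [leapfrogTriejoin, List.mem_map]
  constructor
  · rintro ⟨⟨x, y, z⟩, h, he⟩
    obtain rfl : ![x, y, z] ∘ σ.symm = v := by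
      funext i
      simp only [Prod.mk.injEq] at he
      fin_cases i
      · exact he.1
      · exact he.2.1
      · exact he.2.2
    simpa using h
  · intro h
    have hv : ![v (σ 0), v (σ 1), v (σ 2)] = v ∘ σ := by
      funext i
      fin_cases i <;> rfl
    exact ⟨_, h, by simp [hv]⟩

theorem leapfrogTriejoin_toFinset (σ : Equiv.Perm (Fin 3)) (A : TriDB) :
    (leapfrogTriejoin σ A).val.toFinset = A.result := by
  ext ⟨a, b, c⟩
  rw [List.mem_toFinset]
  exact mem_leapfrogTriejoin (v := ![a, b, c])

theorem leapfrogTriejoin_time_le (σ : Equiv.Perm (Fin 3)) (A : TriDB) :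
    (leapfrogTriejoin σ A).time ≤
      22 ^ 3 * (∏ i, (A.varBound i + 1)) * (Nat.log 2 A.maxCard + 2) := by
  have hne {i j : Fin 3} (h : i ≠ j) : σ i ≠ σ j := σ.injective.ne h
  have hcard (i j : Fin 3) : (A.atom i j).card < 2 ^ (Nat.log 2 A.maxCard + 1) :=
    (A.card_atom_le i j).trans_lt (Nat.lt_pow_succ_log_self one_lt_two _)
  refine (Trie.triejoin_time_le (hcard _ _) (hcard _ _) (hcard _ _)).trans_eq ?_
  rw [TriDB.projSnd_atom, TriDB.projSnd_atom, TriDB.projSnd_atom,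
    TriDB.min_card_projFst_atom (hne (by decide)) (hne (by decide)) (hne (by decide)),
    TriDB.min_card_projFst_atom (hne (by decide)) (hne (by decide)) (hne (by decide)),
    TriDB.min_card_projFst_atom (hne (by decide)) (hne (by decide)) (hne (by decide)),
    ← Equiv.prod_comp σ, Fin.prod_univ_three, mul_assoc (_ + 1) (_ + 1)]

/-! ### The NPRR algorithm -/

namespace Timed

variable {α β : Type}

theorem val_bind (x : Timed α) (f : α → Timed β) : (x >>= f).val = (f x.val).val :=
  rfl

theorem time_bind (x : Timed α) (f : α → Timed β) :
    (x >>= f).time = x.time + (f x.val).time :=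
  rfl

theorem val_pure (a : α) : (pure a : Timed α).val = a :=
  rfl

theorem time_pure (a : α) : (pure a : Timed α).time = 0 :=
  rfl

theorem val_forEach (l : List α) (f : α → Timed (List β)) :
    (forEach l f).val = l.flatMap fun x => (f x).val := by
  induction l with
  | nil => rfl
  | cons x xs ih => simp [forEach, ih]

theorem time_forEach (l : List α) (f : α → Timed (List β)) :
    (forEach l f).time = (l.map fun x => 1 + (f x).time).sum := by
  induction l with
  | nil => rfl
  | cons x xs ih => simp [forEach, ih]

end Timed

theorem val_filterTimed {α : Type} (t : ℕ) (P : α → Prop) [DecidablePred P] (l : List α) :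
    (filterTimed t P l).val = l.filter P := by
  rw [filterTimed, Timed.val_forEach]
  induction l with
  | nil => rfl
  | cons x xs ih => by_cases h : P x <;> simp [h, ih]

theorem time_filterTimed {α : Type} (t : ℕ) (P : α → Prop) [DecidablePred P] (l : List α) :
    (filterTimed t P l).time = l.length * (1 + t) := by
  simp [filterTimed, Timed.time_forEach]

theorem length_filter_toList {α : Type} (s : Finset α) (P : α → Prop) [DecidablePred P] :
    (s.toList.filter P).length = (s.filter P).card := by
  classical
  rw [← List.toFinset_card_of_nodup (s.nodup_toList.filter _), List.toFinset_filter,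
    Finset.toList_toFinset]
  simp

theorem sum_map_filter_toList {α : Type} (s : Finset α) (P : α → Prop) [DecidablePred P]
    (f : α → ℕ) : ((s.toList.filter P).map f).sum = ∑ x ∈ s.filter P, f x := by
  classical
  rw [← List.sum_toFinset _ (s.nodup_toList.filter _), List.toFinset_filter,
    Finset.toList_toFinset]
  simp

/-- The number of pairs `(x, y) ∈ E`, for given `x`. -/
def degFst (E : Finset (ℕ × ℕ)) (x : ℕ) : ℕ := (E.filter fun e => e.1 = x).card

/-- The number of pairs `(x, y) ∈ E`, for given `y`. -/
def degSnd (E : Finset (ℕ × ℕ)) (y : ℕ) : ℕ := (E.filter fun e => e.2 = y).card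

/-- The set `D` of the NPRR algorithm: the keys `y` that appear in more than `τ` pairs of `E`. -/
noncomputable def heavyKeys (τ : ℝ) (E : Finset (ℕ × ℕ)) : Finset ℕ :=
  (projSnd E).filter fun y => τ < degSnd E y

/-- The set `G` of the NPRR algorithm: the pairs in `E` whose key is not heavy. -/
noncomputable def lightPart (τ : ℝ) (E : Finset (ℕ × ℕ)) : Finset (ℕ × ℕ) :=
  E.filter fun e => e.2 ∉ heavyKeys τ E

section Degrees

variable {E : Finset (ℕ × ℕ)} {X Y : Finset ℕ} {x y : ℕ} {τ : ℝ}

theorem degFst_le_card_projSnd (E : Finset (ℕ × ℕ)) (x : ℕ) : degFst E x ≤ (projSnd E).card := by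
  refine Finset.card_le_card_of_injOn Prod.snd (fun e he => ?_) fun e he e' he' h => ?_
  · exact mem_projSnd (Finset.mem_filter.1 he).1
  · exact Prod.ext ((Finset.mem_filter.1 he).2.trans (Finset.mem_filter.1 he').2.symm) h

theorem degSnd_le_card_projFst (E : Finset (ℕ × ℕ)) (y : ℕ) : degSnd E y ≤ (projFst E).card := by
  refine Finset.card_le_card_of_injOn Prod.fst (fun e he => ?_) fun e he e' he' h => ?_
  · exact mem_projFst (Finset.mem_filter.1 he).1
  · exact Prod.ext h ((Finset.mem_filter.1 he).2.trans (Finset.mem_filter.1 he').2.symm)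

theorem degFst_product (hx : x ∈ X) : degFst (X ×ˢ Y) x = Y.card := by
  rw [degFst, Finset.filter_product_left (fun a => a = x), Finset.filter_eq', if_pos hx,
    Finset.card_product, Finset.card_singleton, one_mul]

theorem degSnd_product (hy : y ∈ Y) : degSnd (X ×ˢ Y) y = X.card := by
  rw [degSnd, Finset.filter_product_right (fun b => b = y), Finset.filter_eq', if_pos hy,
    Finset.card_product, Finset.card_singleton, mul_one]

theorem heavyKeys_eq_empty (hτ : ((projFst E).card : ℝ) ≤ τ) : heavyKeys τ E = ∅ :=
  Finset.filter_false_of_mem fun y _ =>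
    not_lt.2 ((Nat.cast_le.2 (degSnd_le_card_projFst E y)).trans hτ)

theorem lightPart_eq_self (hτ : ((projFst E).card : ℝ) ≤ τ) : lightPart τ E = E := by
  simp [lightPart, heavyKeys_eq_empty hτ]

theorem heavyKeys_product (hX : X.Nonempty) (hτ : τ < X.card) : heavyKeys τ (X ×ˢ Y) = Y := by
  rw [heavyKeys, projSnd, Finset.product_image_snd hX]
  exact Finset.filter_true_of_mem fun y hy => by rwa [degSnd_product hy]

theorem lightPart_product (hX : X.Nonempty) (hτ : τ < X.card) : lightPart τ (X ×ˢ Y) = ∅ := by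
  rw [lightPart, heavyKeys_product hX hτ]
  exact Finset.filter_false_of_mem fun e he => not_not.2 (Finset.mem_product.1 he).2

end Degrees

theorem nprr_toFinset (τ : ℝ) (A : TriDB) : (nprr τ A).val.toFinset = A.result := by
  ext ⟨a, b, c⟩
  have hkey : (a, b) ∈ A.R → b ∈ projSnd A.R := mem_projSnd
  rw [A.mem_result]
  simp only [nprr, Timed.val_bind, Timed.val_pure, val_filterTimed, buildHashSet, buildHashIndex,
    buildHashCount, Timed.val_forEach, List.toFinset_append, Finset.mem_union, List.mem_toFinset,
    List.mem_filter, List.mem_flatMap, List.mem_map, List.mem_singleton, Finset.mem_toList,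
    Prod.exists, Prod.mk.injEq, decide_eq_true_eq]
  grind

theorem nprr_time (τ : ℝ) (A : TriDB) :
    (nprr τ A).time = 4 * A.R.card + 2 * A.S.card + A.T.card + 2 * (projSnd A.R).card +
      2 * (heavyKeys τ A.R).card + 5 * ((heavyKeys τ A.R).card * A.T.card) +
      (lightPart τ A.R).card + 4 * ∑ e ∈ lightPart τ A.R, degFst A.S e.2 := by
  have hheavy : heavyKeys τ A.R = (projSnd A.R).filter fun b =>
      τ < ((A.R.filter fun e => e.2 = b).card : ℝ) := rfl
  have hlight : lightPart τ A.R = A.R.filter fun e =>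
      ¬ (e.2 ∈ projSnd A.R ∧ τ < ((A.R.filter fun e' => e'.2 = e.2).card : ℝ)) := by
    ext e
    rw [lightPart, hheavy, Finset.mem_filter, Finset.mem_filter, Finset.mem_filter]
  simp only [nprr, Timed.time_bind, Timed.time_pure, val_filterTimed, time_filterTimed,
    buildHashSet, buildHashIndex, buildHashCount, Timed.val_forEach, Timed.time_forEach,
    length_filter_toList, Finset.length_toList, List.length_flatMap, sum_map_filter_toList,
    List.map_const', List.sum_replicate, List.length_map, List.length_singleton, smul_eq_mul,
    Finset.sum_const, List.mem_toFinset, List.mem_filter, Finset.mem_toList, decide_eq_true_eq,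
    Finset.sum_add_distrib, mul_one]
  rw [← hlight, ← hheavy, ← Finset.sum_mul]
  simp only [degFst]
  ring

theorem nprr_time_of_card_projFst_le {τ : ℝ} {A : TriDB} (hτ : ((projFst A.R).card : ℝ) ≤ τ) :
    (nprr τ A).time = 5 * A.R.card + 2 * A.S.card + A.T.card + 2 * (projSnd A.R).card +
      4 * ∑ e ∈ A.R, degFst A.S e.2 := by
  rw [nprr_time, heavyKeys_eq_empty hτ, lightPart_eq_self hτ, Finset.card_empty]
  ring

theorem nprr_time_le_of_card_projFst_le {τ : ℝ} {A : TriDB}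
    (hτ : ((projFst A.R).card : ℝ) ≤ τ) :
    (nprr τ A).time ≤ 5 * A.R.card + 2 * A.S.card + A.T.card + 2 * (projSnd A.R).card +
      4 * (A.R.card * (projSnd A.S).card) := by
  rw [nprr_time_of_card_projFst_le hτ]
  gcongr
  exact Finset.sum_le_card_nsmul _ _ _ fun e _ => degFst_le_card_projSnd A.S e.2

section Product

variable {X Y Z : Finset ℕ} {T : Finset (ℕ × ℕ)} {τ : ℝ}

theorem le_nprr_time_product (hτ : (X.card : ℝ) ≤ τ) :
    4 * (X.card * Y.card * Z.card) ≤ (nprr τ ⟨X ×ˢ Y, Y ×ˢ Z, T⟩).time := by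
  have hproj : ((projFst (X ×ˢ Y)).card : ℝ) ≤ τ :=
    (Nat.cast_le.2 (Finset.card_le_card Finset.subset_product_image_fst)).trans hτ
  have hjoin : ∑ e ∈ X ×ˢ Y, degFst (Y ×ˢ Z) e.2 = X.card * Y.card * Z.card := by
    rw [Finset.sum_congr rfl fun e he => degFst_product (Finset.mem_product.1 he).2,
      Finset.sum_const, Finset.card_product, smul_eq_mul]
  have htime := nprr_time_of_card_projFst_le (A := ⟨X ×ˢ Y, Y ×ˢ Z, T⟩) hproj
  rw [hjoin] at htime
  exact htime.ge.trans' (Nat.le_add_left _ _)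

theorem nprr_time_product (hX : X.Nonempty) (hτ : τ < X.card) :
    (nprr τ ⟨X ×ˢ Y, Y ×ˢ Z, T⟩).time = 4 * (X.card * Y.card) + 2 * (Y.card * Z.card) + T.card +
      4 * Y.card + 5 * (Y.card * T.card) := by
  rw [nprr_time, heavyKeys_product hX hτ, lightPart_product hX hτ, projSnd,
    Finset.product_image_snd hX, Finset.card_product, Finset.card_product]
  simp only [Finset.card_empty, Finset.sum_empty]
  ring

end Product

/-! ### The skewed family -/

/-- The integer part of `n ^ e`; the bounds of the skewed family are the cases `e = 3 / 8` and
`e = 5 / 8`. -/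
noncomputable def floorRpow (n : ℕ) (e : ℝ) : ℕ := ⌊(n : ℝ) ^ e⌋₊

section FloorRpow

variable {n k : ℕ} {e f : ℝ}

theorem le_floorRpow_iff : k ≤ floorRpow n e ↔ (k : ℝ) ≤ (n : ℝ) ^ e :=
  Nat.le_floor_iff (Real.rpow_nonneg (Nat.cast_nonneg n) e)

theorem floorRpow_le_rpow (n : ℕ) (e : ℝ) : (floorRpow n e : ℝ) ≤ (n : ℝ) ^ e :=
  le_floorRpow_iff.1 le_rfl

theorem one_le_floorRpow (hn : 1 ≤ n) (he : 0 ≤ e) : 1 ≤ floorRpow n e :=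
  le_floorRpow_iff.2 (by simpa using Real.one_le_rpow (Nat.one_le_cast.2 hn) he)

theorem half_rpow_le_floorRpow (hn : 1 ≤ n) (he : 0 ≤ e) :
    (n : ℝ) ^ e / 2 ≤ floorRpow n e :=
  (Nat.div_two_lt_floor (Real.one_le_rpow (Nat.one_le_cast.2 hn) he)).le

theorem floorRpow_mul_floorRpow_le (he : 0 ≤ e) (hf : 0 ≤ f) (hef : e + f = 1) :
    floorRpow n e * floorRpow n f ≤ n := by
  have h : (floorRpow n e : ℝ) * floorRpow n f ≤ (n : ℝ) ^ e * (n : ℝ) ^ f := by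
    gcongr <;> exact floorRpow_le_rpow n _
  rw [← Real.rpow_add_of_nonneg (Nat.cast_nonneg n) he hf, hef, Real.rpow_one] at h
  exact_mod_cast h

theorem floorRpow_le_self (he : 0 < e) (he1 : e ≤ 1) : floorRpow n e ≤ n := by
  rcases Nat.eq_zero_or_pos n with rfl | hn
  · simp [floorRpow, Real.zero_rpow he.ne']
  · have h := Real.rpow_le_rpow_of_exponent_le (Nat.one_le_cast.2 hn) he1
    rw [Real.rpow_one] at h
    exact_mod_cast (floorRpow_le_rpow n e).trans h

end FloorRpow

theorem IsExtremal.unique {K : ℕ → Set TriDB} {q M q' M' : ℕ → ℕ} (h : IsExtremal K q M)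
    (h' : IsExtremal K q' M') : q = q' ∧ M = M' :=
  ⟨funext fun n => (h n).1.unique (h' n).1, funext fun n => (h n).2.unique (h' n).2⟩

theorem IsExtremal.worstCaseOptimalUpToLog_iff {K : ℕ → Set TriDB} {q M : ℕ → ℕ}
    {time : ℕ → TriDB → ℕ} (h : IsExtremal K q M) :
    WorstCaseOptimalUpToLog K time ↔ ∃ C : ℝ, ∃ n₀ : ℕ, ∀ n ≥ n₀, ∀ A ∈ K n,
      (time n A : ℝ) ≤ C * ((q n : ℝ) * Real.logb 2 (M n)) := by
  constructor
  · rintro ⟨q', M', h', htime⟩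
    obtain ⟨rfl, rfl⟩ := h.unique h'
    exact htime
  · exact fun htime => ⟨q, M, h, htime⟩

theorem card_le_card_projFst_mul_card_projSnd (E : Finset (ℕ × ℕ)) :
    E.card ≤ (projFst E).card * (projSnd E).card := by
  rw [← Finset.card_product]
  exact Finset.card_le_card Finset.subset_product

section SkewBounds

variable {n : ℕ} {A : TriDB}

theorem mem_skewBounds_family : A ∈ skewBounds.family n ↔
    (projFst A.R).card ≤ floorRpow n (3 / 8) ∧ (projSnd A.R).card ≤ floorRpow n (5 / 8) ∧
      (projFst A.S).card ≤ floorRpow n (5 / 8) ∧ (projSnd A.S).card ≤ floorRpow n (3 / 8) ∧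
      (projFst A.T).card ≤ n ∧ (projSnd A.T).card ≤ 1 := by
  simp only [ProjBounds.family, skewBounds, Set.mem_ofPred_eq, le_floorRpow_iff, Nat.cast_le,
    Nat.cast_le_one]

theorem floorRpow_mul_le (n : ℕ) : floorRpow n (3 / 8) * floorRpow n (5 / 8) ≤ n :=
  floorRpow_mul_floorRpow_le (by norm_num) (by norm_num) (by norm_num)

theorem card_le_of_mem_skewBounds (hA : A ∈ skewBounds.family n) :
    A.R.card ≤ n ∧ A.S.card ≤ n ∧ A.T.card ≤ n := by
  obtain ⟨hRa, hRb, hSb, hSc, hTa, hTc⟩ := mem_skewBounds_family.1 hA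
  refine ⟨?_, ?_, ?_⟩ <;> refine (card_le_card_projFst_mul_card_projSnd _).trans ?_
  · exact (Nat.mul_le_mul hRa hRb).trans (floorRpow_mul_le n)
  · exact (Nat.mul_le_mul hSb hSc).trans ((Nat.mul_comm _ _).trans_le (floorRpow_mul_le n))
  · exact (Nat.mul_le_mul hTa hTc).trans_eq (mul_one n)

theorem maxCard_le_of_mem_skewBounds (hA : A ∈ skewBounds.family n) : A.maxCard ≤ n := by
  obtain ⟨hR, hS, hT⟩ := card_le_of_mem_skewBounds hA
  exact max_le hR (max_le hS hT)

theorem varBound_le_of_mem_skewBounds (hA : A ∈ skewBounds.family n) :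
    A.varBound 0 ≤ floorRpow n (3 / 8) ∧ A.varBound 1 ≤ floorRpow n (5 / 8) ∧
      A.varBound 2 ≤ 1 := by
  obtain ⟨hRa, hRb, -, -, -, hTc⟩ := mem_skewBounds_family.1 hA
  exact ⟨min_le_of_left_le hRa, min_le_of_left_le hRb, min_le_of_right_le hTc⟩

theorem card_result_le_of_mem_skewBounds (hA : A ∈ skewBounds.family n) :
    A.result.card ≤ floorRpow n (3 / 8) * floorRpow n (5 / 8) := by
  obtain ⟨ha, hb, hc⟩ := varBound_le_of_mem_skewBounds hA
  refine A.card_result_le_prod_varBound.trans ?_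
  rw [Fin.prod_univ_three, ← mul_one (floorRpow _ _ * _)]
  gcongr

theorem productInstance_eq (n : ℕ) : productInstance n =
    { R := Finset.Icc 1 (floorRpow n (3 / 8)) ×ˢ Finset.Icc 1 (floorRpow n (5 / 8))
      S := Finset.Icc 1 (floorRpow n (5 / 8)) ×ˢ Finset.Icc 1 (floorRpow n (3 / 8))
      T := Finset.Icc 1 n ×ˢ Finset.Icc 1 1 } :=
  rfl

theorem productInstance_mem (n : ℕ) : productInstance n ∈ skewBounds.family n := by
  have hfst (k l : ℕ) : (projFst (Finset.Icc 1 k ×ˢ Finset.Icc 1 l)).card ≤ k :=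
    (Finset.card_le_card Finset.subset_product_image_fst).trans_eq (Nat.card_Icc 1 k)
  have hsnd (k l : ℕ) : (projSnd (Finset.Icc 1 k ×ˢ Finset.Icc 1 l)).card ≤ l :=
    (Finset.card_le_card Finset.subset_product_image_snd).trans_eq (Nat.card_Icc 1 l)
  exact mem_skewBounds_family.2 ⟨hfst _ _, hsnd _ _, hfst _ _, hsnd _ _, hfst _ _, hsnd _ _⟩

theorem card_result_productInstance (n : ℕ) :
    (productInstance n).result.card = floorRpow n (3 / 8) * floorRpow n (5 / 8) := by
  refine le_antisymm (card_result_le_of_mem_skewBounds (productInstance_mem n)) ?_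
  have hle : floorRpow n (3 / 8) ≤ n := floorRpow_le_self (by norm_num) (by norm_num)
  have hsub : Finset.Icc 1 (floorRpow n (3 / 8)) ×ˢ Finset.Icc 1 (floorRpow n (5 / 8)) ×ˢ {1} ⊆
      (productInstance n).result := by
    rintro ⟨a, b, c⟩ h
    simp only [Finset.mem_product, Finset.mem_Icc, Finset.mem_singleton] at h
    simp only [TriDB.mem_result, productInstance_eq, Finset.mem_product, Finset.mem_Icc]
    omega
  simpa using Finset.card_le_card hsub

theorem maxCard_productInstance (n : ℕ) : (productInstance n).maxCard = n := by
  have hT : (productInstance n).T.card = n := by simp [productInstance]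
  exact le_antisymm (maxCard_le_of_mem_skewBounds (productInstance_mem n))
    (hT.ge.trans ((le_max_right _ _).trans (le_max_right _ _)))

theorem isExtremal_skewBounds : IsExtremal skewBounds.family
    (fun n => floorRpow n (3 / 8) * floorRpow n (5 / 8)) fun n => n := by
  refine fun n => ⟨⟨⟨_, productInstance_mem n, card_result_productInstance n⟩, ?_⟩,
    ⟨_, productInstance_mem n, maxCard_productInstance n⟩, ?_⟩
  · exact Set.forall_mem_image.2 fun _ hA => card_result_le_of_mem_skewBounds hA
  · exact Set.forall_mem_image.2 fun _ hA => maxCard_le_of_mem_skewBounds hA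

/-! ### Leapfrog triejoin on the skewed family -/

theorem natLog_add_two_le (hn : 2 ≤ n) : ((Nat.log 2 n + 2 : ℕ) : ℝ) ≤ 3 * Real.logb 2 n := by
  have hlog : (Nat.log 2 n : ℝ) ≤ Real.logb 2 n := Real.natLog_le_logb n 2
  have hone : (1 : ℝ) ≤ Nat.log 2 n := by
    exact_mod_cast Nat.log_pos one_lt_two hn
  push_cast
  linarith

theorem leapfrogTriejoin_time_le_of_mem_skewBounds (hn : 2 ≤ n) (hA : A ∈ skewBounds.family n)
    (σ : Equiv.Perm (Fin 3)) : ((leapfrogTriejoin σ A).time : ℝ) ≤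
      22 ^ 3 * 24 * ((floorRpow n (3 / 8) * floorRpow n (5 / 8) : ℕ) * Real.logb 2 n) := by
  set α := floorRpow n (3 / 8)
  set β := floorRpow n (5 / 8)
  have hα1 : 1 ≤ α := one_le_floorRpow (by lia) (by norm_num)
  have hβ1 : 1 ≤ β := one_le_floorRpow (by lia) (by norm_num)
  obtain ⟨ha, hb, hc⟩ := varBound_le_of_mem_skewBounds hA
  have hprod : ∏ i, (A.varBound i + 1) ≤ 8 * (α * β) := by
    rw [Fin.prod_univ_three]
    calc (A.varBound 0 + 1) * (A.varBound 1 + 1) * (A.varBound 2 + 1)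
        ≤ (α + α) * (β + β) * (1 + 1) := by gcongr
      _ = 8 * (α * β) := by ring
  calc ((leapfrogTriejoin σ A).time : ℝ)
      ≤ (22 ^ 3 * (8 * (α * β)) * (Nat.log 2 n + 2) : ℕ) := by
        refine Nat.cast_le.2 ((leapfrogTriejoin_time_le σ A).trans ?_)
        gcongr
        exact maxCard_le_of_mem_skewBounds hA
    _ = 22 ^ 3 * 8 * (α * β : ℕ) * (Nat.log 2 n + 2 : ℕ) := by push_cast; ring
    _ ≤ 22 ^ 3 * 8 * (α * β : ℕ) * (3 * Real.logb 2 n) := by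
        gcongr
        exact natLog_add_two_le hn
    _ = 22 ^ 3 * 24 * ((α * β : ℕ) * Real.logb 2 n) := by ring

theorem leapfrogTriejoin_time_le_mul_logb (hn : 2 ≤ n) (hA : A ∈ skewBounds.family n)
    (σ : Equiv.Perm (Fin 3)) :
    ((leapfrogTriejoin σ A).time : ℝ) ≤ 22 ^ 3 * 24 * (n * Real.logb 2 n) := by
  have hlog : 0 ≤ Real.logb 2 n := Real.logb_nonneg one_lt_two (Nat.one_le_cast.2 (by lia))
  refine (leapfrogTriejoin_time_le_of_mem_skewBounds hn hA σ).trans ?_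
  gcongr
  exact floorRpow_mul_le n

theorem leapfrogTriejoin_optimal (σ : Equiv.Perm (Fin 3)) :
    WorstCaseOptimalUpToLog skewBounds.family fun _ A => (leapfrogTriejoin σ A).time :=
  isExtremal_skewBounds.worstCaseOptimalUpToLog_iff.2 ⟨22 ^ 3 * 24, 2, fun _ hn _ hA =>
    leapfrogTriejoin_time_le_of_mem_skewBounds hn hA σ⟩

/-! ### NPRR on the skewed family -/

theorem nprr_time_le_of_mem_skewBounds (hn : 1 ≤ n) {τ : ℝ} (hτ : (floorRpow n (3 / 8) : ℝ) ≤ τ)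
    (hA : A ∈ skewBounds.family n) : ((nprr τ A).time : ℝ) ≤ 16 * (n : ℝ) ^ (1.375 : ℝ) := by
  obtain ⟨hRa, hRb, -, hSc, -, -⟩ := mem_skewBounds_family.1 hA
  obtain ⟨hR, hS, hT⟩ := card_le_of_mem_skewBounds hA
  have hβ : floorRpow n (5 / 8) ≤ n := floorRpow_le_self (by norm_num) (by norm_num)
  have htime : (nprr τ A).time ≤ 10 * n + 4 * (n * floorRpow n (3 / 8)) :=
    calc (nprr τ A).time
        ≤ 5 * A.R.card + 2 * A.S.card + A.T.card + 2 * (projSnd A.R).card +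
            4 * (A.R.card * (projSnd A.S).card) :=
          nprr_time_le_of_card_projFst_le ((Nat.cast_le.2 hRa).trans hτ)
      _ ≤ 5 * n + 2 * n + n + 2 * n + 4 * (n * floorRpow n (3 / 8)) := by
          gcongr
          exact hRb.trans hβ
      _ = 10 * n + 4 * (n * floorRpow n (3 / 8)) := by ring
  have hn1 : (1 : ℝ) ≤ n := Nat.one_le_cast.2 hn
  have hpow : (n : ℝ) ^ (1.375 : ℝ) = n * (n : ℝ) ^ (3 / 8 : ℝ) := by
    rw [← Real.rpow_one_add' (by positivity) (by norm_num)]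
    norm_num
  calc ((nprr τ A).time : ℝ) ≤ 10 * n + 4 * (n * floorRpow n (3 / 8)) := by exact_mod_cast htime
    _ ≤ 10 * (n : ℝ) ^ (1.375 : ℝ) + 4 * (n : ℝ) ^ (1.375 : ℝ) := by
        gcongr
        · exact Real.self_le_rpow_of_one_le hn1 (by norm_num)
        · rw [hpow]
          gcongr
          exact floorRpow_le_rpow n _
    _ ≤ 16 * (n : ℝ) ^ (1.375 : ℝ) := by linarith [Real.rpow_nonneg n.cast_nonneg (1.375 : ℝ)]

theorem le_nprr_time_productInstance_of_le (hn : 1 ≤ n) {τ : ℝ}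
    (hτ : (floorRpow n (3 / 8) : ℝ) ≤ τ) :
    1 / 2 * (n : ℝ) ^ (1.375 : ℝ) ≤ (nprr τ (productInstance n)).time := by
  have htime : 4 * (floorRpow n (3 / 8) * floorRpow n (5 / 8) * floorRpow n (3 / 8)) ≤
      (nprr τ (productInstance n)).time := by
    rw [productInstance_eq]
    refine le_trans ?_ (le_nprr_time_product (by simpa using hτ))
    simp
  have hpos : (0 : ℝ) < n := Nat.cast_pos.2 hn
  have hpow : (n : ℝ) ^ (1.375 : ℝ) =
      (n : ℝ) ^ (3 / 8 : ℝ) * (n : ℝ) ^ (5 / 8 : ℝ) * (n : ℝ) ^ (3 / 8 : ℝ) := by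
    rw [← Real.rpow_add hpos, ← Real.rpow_add hpos]
    norm_num
  calc 1 / 2 * (n : ℝ) ^ (1.375 : ℝ)
      = 4 * ((n : ℝ) ^ (3 / 8 : ℝ) / 2 * ((n : ℝ) ^ (5 / 8 : ℝ) / 2) *
          ((n : ℝ) ^ (3 / 8 : ℝ) / 2)) := by rw [hpow]; ring
    _ ≤ 4 * (floorRpow n (3 / 8) * floorRpow n (5 / 8) * floorRpow n (3 / 8)) := by
        gcongr <;> exact half_rpow_le_floorRpow hn (by norm_num)
    _ ≤ (nprr τ (productInstance n)).time := by exact_mod_cast htime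

theorem nprr_time_productInstance_of_lt (hn : 1 ≤ n) {τ : ℝ} (hτ : τ < floorRpow n (3 / 8)) :
    (nprr τ (productInstance n)).time = 6 * (floorRpow n (3 / 8) * floorRpow n (5 / 8)) + n +
      4 * floorRpow n (5 / 8) + 5 * (floorRpow n (5 / 8) * n) := by
  have hne : (Finset.Icc 1 (floorRpow n (3 / 8))).Nonempty :=
    Finset.nonempty_Icc.2 (one_le_floorRpow hn (by norm_num))
  rw [productInstance_eq, nprr_time_product hne (by simpa using hτ)]
  simp only [Nat.card_Icc, Nat.add_sub_cancel, Finset.card_product, mul_one]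
  ring

theorem nprr_time_productInstance_bounds_of_lt (hn : 1 ≤ n) {τ : ℝ}
    (hτ : τ < floorRpow n (3 / 8)) :
    1 / 2 * (n : ℝ) ^ (1.625 : ℝ) ≤ (nprr τ (productInstance n)).time ∧
      ((nprr τ (productInstance n)).time : ℝ) ≤ 16 * (n : ℝ) ^ (1.625 : ℝ) := by
  have hn1 : (1 : ℝ) ≤ n := Nat.one_le_cast.2 hn
  have hpow : (n : ℝ) ^ (1.625 : ℝ) = (n : ℝ) ^ (5 / 8 : ℝ) * n := by
    rw [← Real.rpow_add_one' (by positivity) (by norm_num)]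
    norm_num
  have hαβ : ((floorRpow n (3 / 8) * floorRpow n (5 / 8) : ℕ) : ℝ) ≤ n :=
    Nat.cast_le.2 (floorRpow_mul_le n)
  have hβ : (floorRpow n (5 / 8) : ℝ) ≤ n :=
    Nat.cast_le.2 (floorRpow_le_self (by norm_num) (by norm_num))
  have hself : (n : ℝ) ≤ (n : ℝ) ^ (1.625 : ℝ) := Real.self_le_rpow_of_one_le hn1 (by norm_num)
  have hlower : (n : ℝ) ^ (1.625 : ℝ) / 2 ≤ floorRpow n (5 / 8) * n := by
    rw [hpow, mul_div_right_comm]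
    gcongr
    exact half_rpow_le_floorRpow hn (by norm_num)
  have hupper : (floorRpow n (5 / 8) : ℝ) * n ≤ (n : ℝ) ^ (1.625 : ℝ) := by
    rw [hpow]
    gcongr
    exact floorRpow_le_rpow n _
  rw [nprr_time_productInstance_of_lt hn hτ]
  push_cast at hαβ ⊢
  constructor <;> nlinarith

theorem le_nprr_time_productInstance (hn : 1 ≤ n) (τ : ℝ) :
    1 / 2 * (n : ℝ) ^ (1.375 : ℝ) ≤ (nprr τ (productInstance n)).time := by
  rcases le_or_gt (floorRpow n (3 / 8) : ℝ) τ with hτ | hτ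
  · exact le_nprr_time_productInstance_of_le hn hτ
  · refine le_trans ?_ (nprr_time_productInstance_bounds_of_lt hn hτ).1
    have hn1 : (1 : ℝ) ≤ n := Nat.one_le_cast.2 hn
    gcongr
    norm_num

end SkewBounds

open Filter Asymptotics in
theorem isLittleO_mul_logb_rpow {b s : ℝ} (hs : 1 < s) :
    (fun x : ℝ => x * Real.logb b x) =o[atTop] fun x => x ^ s := by
  have hlog : (fun x : ℝ => Real.logb b x) =o[atTop] fun x => x ^ (s - 1) := by
    simpa only [Real.logb, div_eq_inv_mul] using
      (isLittleO_log_rpow_atTop (sub_pos.2 hs)).const_mul_left (Real.log b)⁻¹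
  refine ((isBigO_refl (fun x : ℝ => x) atTop).mul_isLittleO hlog).congr' .rfl ?_
  filter_upwards [eventually_gt_atTop 0] with x hx
  rw [← Real.rpow_one_add' hx.le (by linarith), add_sub_cancel]

open Filter Asymptotics in
theorem nprr_not_optimal (τ : ℕ → TriDB → ℝ) :
    ¬ WorstCaseOptimalUpToLog skewBounds.family fun n A => (nprr (τ n A) A).time := by
  rw [isExtremal_skewBounds.worstCaseOptimalUpToLog_iff]
  rintro ⟨C, n₀, h⟩
  have hbound : (fun n : ℕ => (n : ℝ) ^ (1.375 : ℝ)) =O[atTop]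
      fun n : ℕ => (n : ℝ) * Real.logb 2 n := by
    refine .of_bound (2 * |C|) ?_
    filter_upwards [eventually_ge_atTop n₀, eventually_ge_atTop 1] with n hn₀ hn
    have hlog : 0 ≤ Real.logb 2 n := Real.logb_nonneg one_lt_two (Nat.one_le_cast.2 hn)
    have hlower := (le_nprr_time_productInstance hn (τ n (productInstance n))).trans
      (h n hn₀ _ (productInstance_mem n))
    have hupper : C * ((floorRpow n (3 / 8) * floorRpow n (5 / 8) : ℕ) * Real.logb 2 n) ≤
        |C| * (n * Real.logb 2 n) := by
      gcongr
      · exact le_abs_self C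
      · exact floorRpow_mul_le n
    rw [Real.norm_of_nonneg (by positivity), Real.norm_of_nonneg (by positivity)]
    linarith
  refine isLittleO_irrefl (Eventually.frequently ?_)
    (hbound.trans_isLittleO ((isLittleO_mul_logb_rpow (by norm_num)).comp_tendsto
      tendsto_natCast_atTop_atTop))
  filter_upwards [eventually_gt_atTop 0] with n hn
  positivity

theorem mainTheorem4 :
    -- both algorithms compute the query result
    (∀ (σ : Equiv.Perm (Fin 3)) (A : TriDB), (leapfrogTriejoin σ A).val.toFinset = A.result) ∧
    (∀ (τ : ℝ) (A : TriDB), 0 ≤ τ → (nprr τ A).val.toFinset = A.result) ∧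
    -- leapfrog triejoin runs in O(n log n) over the family
    (∃ C : ℝ, ∀ n : ℕ, 2 ≤ n → ∀ A ∈ skewBounds.family n, ∀ σ : Equiv.Perm (Fin 3),
      ((leapfrogTriejoin σ A).time : ℝ) ≤ C * ((n : ℝ) * Real.logb 2 n)) ∧
    -- the product instances belong to the family
    (∀ n : ℕ, productInstance n ∈ skewBounds.family n) ∧
    -- the running time of NPRR, with constants that do not depend on n and τ
    (∃ c C : ℝ, 0 < c ∧ ∀ n : ℕ, 1 ≤ n → ∀ τ : ℝ, 0 ≤ τ →
      ((⌊(n : ℝ) ^ (3 / 8 : ℝ)⌋₊ : ℝ) ≤ τ →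
        c * (n : ℝ) ^ (1.375 : ℝ) ≤ (nprr τ (productInstance n)).time ∧
        ((nprr τ (productInstance n)).time : ℝ) ≤ C * (n : ℝ) ^ (1.375 : ℝ)) ∧
      (τ < (⌊(n : ℝ) ^ (3 / 8 : ℝ)⌋₊ : ℝ) →
        c * (n : ℝ) ^ (1.625 : ℝ) ≤ (nprr τ (productInstance n)).time ∧
        ((nprr τ (productInstance n)).time : ℝ) ≤ C * (n : ℝ) ^ (1.625 : ℝ)) ∧
      c * (n : ℝ) ^ (1.375 : ℝ) ≤ (nprr τ (productInstance n)).time ∧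
      ((⌊(n : ℝ) ^ (3 / 8 : ℝ)⌋₊ : ℝ) ≤ τ → ∀ A ∈ skewBounds.family n,
        ((nprr τ A).time : ℝ) ≤ C * (n : ℝ) ^ (1.375 : ℝ))) ∧
    -- leapfrog triejoin is worst-case optimal (up to a log factor) for the family, and NPRR is not,
    -- for any choice of its threshold, even one that depends on the instance
    (∀ σ : Equiv.Perm (Fin 3),
      WorstCaseOptimalUpToLog skewBounds.family fun _ A => (leapfrogTriejoin σ A).time) ∧
    (∀ τ : ℕ → TriDB → ℝ, (∀ n A, 0 ≤ τ n A) →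
      ¬ WorstCaseOptimalUpToLog skewBounds.family fun n A => (nprr (τ n A) A).time) := by
  refine ⟨leapfrogTriejoin_toFinset, fun τ A _ => nprr_toFinset τ A,
    ⟨22 ^ 3 * 24, fun n hn A hA σ => leapfrogTriejoin_time_le_mul_logb hn hA σ⟩,
    productInstance_mem,
    ⟨1 / 2, 16, by norm_num, fun n hn τ _ => ⟨fun hτ => ?_, fun hτ => ?_, ?_, fun hτ A hA => ?_⟩⟩,
    leapfrogTriejoin_optimal, fun τ _ => nprr_not_optimal τ⟩
  · exact ⟨le_nprr_time_productInstance hn τ,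
      nprr_time_le_of_mem_skewBounds hn hτ (productInstance_mem n)⟩
  · exact nprr_time_productInstance_bounds_of_lt hn hτ
  · exact le_nprr_time_productInstance hn τ
  · exact nprr_time_le_of_mem_skewBounds hn hτ hA
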